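/- Let $(\mathcal H,\langle\cdot,\cdot\rangle)$ be a complex separable Hilbert space, $L(\mathcal H)$ the bounded operators on it with the operator norm, and $J\in L(\mathcal H)$ a symmetry, $J=J^*=J^{-1}$. Put $[f,g]=\langle Jf,g\rangle$ and $T^{\#}=JT^*J$ for $T\in L(\mathcal H)$; let $$\mathcal U_J=\{U\in L(\mathcal H): UU^{\#}=U^{\#}U=I\},\qquad \mathcal E=\{E\in L(\mathcal H): E^2=E,\ E^{\#}=E\},$$ and let $\mathcal U_J\cdot E_0=\{UE_0U^{\#}: U\in\mathcal U_J\}$ for $E_0\in\mathcal E$. For a subspace $\mathcal S$ put $\mathcal S^{[\perp]}=\{f: [f,g]=0\ \text{for all } g\in\mathcal S\}$ and $\mathcal S^\circ=\mathcal S\cap\mathcal S^{[\perp]}$; $\mathcal S$ is regular if $\mathcal S\dotplus\mathcal S^{[\perp]}=\mathcal H$, and uniformly $J$-positive (resp. $J$-negative) if for some $c>0$ one has $[f,f]\ge c\|f\|^2$ (resp. $[f,f]\le -c\|f\|^2$) for all $f\in\mathcal S$. If $\mathcal S=\mathcal S^\circ\dotplus\mathcal M_+\dotplus\mathcal M_-$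 with $\mathcal M_+$ uniformly $J$-positive, $\mathcal M_-$ uniformly $J$-negative, $\mathcal M_+$ and $\mathcal M_-$ $J$-orthogonal, and $\mathcal M_+\dotplus\mathcal M_-$ regular, then the positive and negative signatures of $\mathcal S$ are $\kappa_\pm(\mathcal S)=\dim\mathcal M_\pm\in\{0,1,2,\dots,\infty\}$; they do not depend on the decomposition. The positive and negative cosignatures of $\mathcal S$ are $c\kappa_\pm(\mathcal S)=\kappa_\pm(\mathcal S^{[\perp]})$. (All of these are defined when $\mathcal S$ is the range $R(E)$ of some $E\in\mathcal E$.) Let $E,E_0\in\mathcal E$. The following are equivalent: (i) $E\in\mathcal U_J\cdot E_0$; (ii) $\kappa_+(R(E))=\kappa_+(R(E_0))$, $\kappa_-(R(E))=\kappa_-(R(E_0))$, $c\kappa_+(R(E))=c\kappa_+(R(E_0))$ and $c\kappa_-(R(E))=c\kappa_-(R(E_0))$. Moreover, the connected component of $E_0$ in $\mathcal E$, for the operator norm topology, coincides with $\mathcal U_J\cdot E_0$. -/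

import Mathlib

namespace Krein

noncomputable section

variable {H : Type*} [NormedAddCommGroup H] [InnerProductSpace ℂ H]

/-- A symmetry of the Hilbert space `H`: `J = J* = J⁻¹`. -/
def IsSymmetry [CompleteSpace H] (J : H →L[ℂ] H) : Prop :=
  ContinuousLinearMap.adjoint J = J ∧ J * J = 1

/-- The indefinite inner product `[f, g] = ⟨J f, g⟩`, linear in `f` and conjugate linear in `g`
(Mathlib's `inner` is conjugate linear in its first argument). -/
def kreinInner (J : H →L[ℂ] H) (f g : H) : ℂ := inner ℂ g (J f)

/-- The `J`-adjoint `T^# = J T* J`. -/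
def jAdjoint [CompleteSpace H] (J T : H →L[ℂ] H) : H →L[ℂ] H :=
  J * ContinuousLinearMap.adjoint T * J

/-- The group of bounded `J`-unitary operators, as a subset of `L(H)`. -/
def jUnitaries [CompleteSpace H] (J : H →L[ℂ] H) : Set (H →L[ℂ] H) :=
  {U | U * jAdjoint J U = 1 ∧ jAdjoint J U * U = 1}

/-- The set of `J`-selfadjoint projections. -/
def jSelfadjointProjections [CompleteSpace H] (J : H →L[ℂ] H) : Set (H →L[ℂ] H) :=
  {E | E * E = E ∧ jAdjoint J E = E}

/-- The orbit of `E₀` under the action `U · E₀ = U E₀ U^#` of the `J`-unitary group. -/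
def jOrbit [CompleteSpace H] (J E₀ : H →L[ℂ] H) : Set (H →L[ℂ] H) :=
  {E | ∃ U ∈ jUnitaries J, E = U * E₀ * jAdjoint J U}

/-- The `J`-orthogonal subspace `S^[⊥]`. -/
def jOrthogonal (J : H →L[ℂ] H) (S : Submodule ℂ H) : Submodule ℂ H where
  carrier := {f | ∀ g ∈ S, kreinInner J f g = 0}
  add_mem' := by
    intro a b ha hb g hg
    have h1 := ha g hg
    have h2 := hb g hg
    simp only [kreinInner] at h1 h2 ⊢
    rw [map_add, inner_add_right, h1, h2, add_zero]
  zero_mem' := by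
    intro g _
    simp [kreinInner]
  smul_mem' := by
    intro c a ha g hg
    have h1 := ha g hg
    simp only [kreinInner] at h1 ⊢
    rw [map_smul, inner_smul_right, h1, mul_zero]

/-- The isotropic part `S° = S ∩ S^[⊥]`. -/
def isotropicPart (J : H →L[ℂ] H) (S : Submodule ℂ H) : Submodule ℂ H :=
  S ⊓ jOrthogonal J S

/-- `S` is uniformly `J`-positive. The number `[f, f]` is real when `J` is a symmetry. -/
def UniformlyJPositive (J : H →L[ℂ] H) (S : Submodule ℂ H) : Prop :=
  ∃ c : ℝ, 0 < c ∧ ∀ f ∈ S, c * ‖f‖ ^ 2 ≤ (kreinInner J f f).re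

/-- `S` is uniformly `J`-negative. -/
def UniformlyJNegative (J : H →L[ℂ] H) (S : Submodule ℂ H) : Prop :=
  ∃ c : ℝ, 0 < c ∧ ∀ f ∈ S, (kreinInner J f f).re ≤ -(c * ‖f‖ ^ 2)

/-- `S` is regular: `H` is the direct sum of `S` and `S^[⊥]`. -/
def IsJRegular (J : H →L[ℂ] H) (S : Submodule ℂ H) : Prop :=
  IsCompl S (jOrthogonal J S)

/-- A decomposition `S = S° [∔] M₊ [∔] M₋` with `M₊` uniformly `J`-positive, `M₋` uniformly
`J`-negative and `M₊ [∔] M₋` regular. -/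
structure IsSignatureDecomposition (J : H →L[ℂ] H) (S Mp Mm : Submodule ℂ H) : Prop where
  uniformlyPositive : UniformlyJPositive J Mp
  uniformlyNegative : UniformlyJNegative J Mm
  orthogonal : ∀ f ∈ Mp, ∀ g ∈ Mm, kreinInner J f g = 0
  disjoint : Disjoint Mp Mm
  regular : IsJRegular J (Mp ⊔ Mm)
  isotropic_disjoint : Disjoint (isotropicPart J S) (Mp ⊔ Mm)
  sup_eq : isotropicPart J S ⊔ (Mp ⊔ Mm) = S

/-- The dimension in `{0, 1, 2, …, ∞}` of a subspace of a separable Hilbert space: the usual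
dimension if it is finite, and `∞` otherwise. -/
def dim (M : Submodule ℂ H) : ℕ∞ := Cardinal.toENat (Module.rank ℂ M)

/-- The positive signature `κ₊(S)`: the dimension of `M₊` in a decomposition
`S = S° [∔] M₊ [∔] M₋`. It does not depend on the decomposition, see `posSignature_eq`,
so the infimum is over a one-point set whenever `S` has such a decomposition. -/
def posSignature (J : H →L[ℂ] H) (S : Submodule ℂ H) : ℕ∞ :=
  sInf {n | ∃ Mp Mm : Submodule ℂ H, IsSignatureDecomposition J S Mp Mm ∧ n = dim Mp}

/-- The negative signature `κ₋(S)`: the dimension of `M₋` in a decomposition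
`S = S° [∔] M₊ [∔] M₋`. It does not depend on the decomposition, see `negSignature_eq`. -/
def negSignature (J : H →L[ℂ] H) (S : Submodule ℂ H) : ℕ∞ :=
  sInf {n | ∃ Mp Mm : Submodule ℂ H, IsSignatureDecomposition J S Mp Mm ∧ n = dim Mm}

/-- The positive cosignature `cκ₊(S) = κ₊(S^[⊥])`. -/
def posCosignature (J : H →L[ℂ] H) (S : Submodule ℂ H) : ℕ∞ :=
  posSignature J (jOrthogonal J S)

/-- The negative cosignature `cκ₋(S) = κ₋(S^[⊥])`. -/
def negCosignature (J : H →L[ℂ] H) (S : Submodule ℂ H) : ℕ∞ :=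
  negSignature J (jOrthogonal J S)

/-! Independence of the signatures from the decomposition. -/

theorem dim_le_of_disjoint {A B N : Submodule ℂ H} (hd : Disjoint A N) (hle : A ≤ N ⊔ B) :
    dim A ≤ dim B := by
  refine Cardinal.toENat.monotone' ?_
  have hinj : Function.Injective (N.mkQ.domRestrict A) := by
    rw [← LinearMap.ker_eq_bot, LinearMap.ker_eq_bot']
    intro x hx
    have hxN : (x : H) ∈ N := by simpa using hx
    have h0 := (Submodule.disjoint_def.mp hd) x x.2 hxN
    exact Subtype.ext h0
  have h1 : Module.rank ℂ A = Module.rank ℂ (LinearMap.range (N.mkQ.domRestrict A)) :=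
    (LinearEquiv.ofInjective _ hinj).rank_eq
  have h2 : LinearMap.range (N.mkQ.domRestrict A) ≤ B.map N.mkQ := by
    rw [LinearMap.range_domRestrict]
    refine (Submodule.map_mono hle).trans ?_
    rw [Submodule.map_sup]
    simp
  rw [h1]
  exact (Submodule.rank_mono h2).trans (rank_map_le _ _)

theorem kreinInner_conj [CompleteSpace H] {J : H →L[ℂ] H} (hJ : IsSymmetry J) (f g : H) :
    (starRingEnd ℂ) (kreinInner J f g) = kreinInner J g f := by
  unfold kreinInner
  rw [inner_conj_symm]
  conv_lhs => rw [← hJ.1]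
  rw [ContinuousLinearMap.adjoint_inner_left]

theorem kreinInner_isotropic_add [CompleteSpace H] {J : H →L[ℂ] H} (hJ : IsSymmetry J)
    {S : Submodule ℂ H} {s n : H} (hs : s ∈ isotropicPart J S) (hn : n ∈ S) :
    kreinInner J (s + n) (s + n) = kreinInner J n n := by
  have h1 : kreinInner J s s = 0 := hs.2 s hs.1
  have h2 : kreinInner J s n = 0 := hs.2 n hn
  have h3 : kreinInner J n s = 0 := by rw [← kreinInner_conj hJ, h2, map_zero]
  simp only [kreinInner] at h1 h2 h3 ⊢
  rw [map_add, inner_add_left, inner_add_right, inner_add_right, h1, h2, h3]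
  simp

theorem isotropic_sup_disjoint [CompleteSpace H] {J : H →L[ℂ] H} (hJ : IsSymmetry J)
    {S P N : Submodule ℂ H} (hN : N ≤ S) (hP : UniformlyJPositive J P)
    (hNeg : UniformlyJNegative J N) (hPS : P ≤ S) :
    Disjoint P (isotropicPart J S ⊔ N) ∧ Disjoint N (isotropicPart J S ⊔ P) := by
  obtain ⟨c, hc, hP⟩ := hP
  obtain ⟨d, hd, hNeg⟩ := hNeg
  constructor
  · rw [Submodule.disjoint_def]
    intro x hx hx'
    obtain ⟨s, hs, n, hn, rfl⟩ := Submodule.mem_sup.mp hx'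
    have h1 := hP _ hx
    rw [kreinInner_isotropic_add hJ hs (hN hn)] at h1
    have h2 := hNeg n hn
    have h3 : 0 ≤ d * ‖n‖ ^ 2 := by positivity
    have h4 : ‖s + n‖ ^ 2 ≤ 0 := by
      by_contra h
      push Not at h
      nlinarith [mul_pos hc h]
    have h5 : ‖s + n‖ = 0 := by
      have := sq_nonneg ‖s + n‖
      exact pow_eq_zero_iff (two_ne_zero) |>.mp (le_antisymm h4 this)
    exact norm_eq_zero.mp h5
  · rw [Submodule.disjoint_def]
    intro x hx hx'
    obtain ⟨s, hs, n, hn, rfl⟩ := Submodule.mem_sup.mp hx'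
    have h1 := hNeg _ hx
    rw [kreinInner_isotropic_add hJ hs (hPS hn)] at h1
    have h2 := hP n hn
    have h3 : 0 ≤ c * ‖n‖ ^ 2 := by positivity
    have h4 : ‖s + n‖ ^ 2 ≤ 0 := by
      by_contra h
      push Not at h
      nlinarith [mul_pos hd h]
    have h5 : ‖s + n‖ = 0 := by
      have := sq_nonneg ‖s + n‖
      exact pow_eq_zero_iff (two_ne_zero) |>.mp (le_antisymm h4 this)
    exact norm_eq_zero.mp h5

theorem IsSignatureDecomposition.le_left {J : H →L[ℂ] H} {S P N : Submodule ℂ H}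
    (h : IsSignatureDecomposition J S P N) : P ≤ S := by
  conv_rhs => rw [← h.sup_eq]
  exact le_sup_left.trans le_sup_right

theorem IsSignatureDecomposition.le_right {J : H →L[ℂ] H} {S P N : Submodule ℂ H}
    (h : IsSignatureDecomposition J S P N) : N ≤ S := by
  conv_rhs => rw [← h.sup_eq]
  exact le_sup_right.trans le_sup_right

theorem IsSignatureDecomposition.dim_le [CompleteSpace H] {J : H →L[ℂ] H} (hJ : IsSymmetry J)
    {S P N P' N' : Submodule ℂ H} (h : IsSignatureDecomposition J S P N)
    (h' : IsSignatureDecomposition J S P' N') : dim P ≤ dim P' ∧ dim N ≤ dim N' := by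
  constructor
  · refine dim_le_of_disjoint (isotropic_sup_disjoint hJ h'.le_right h.uniformlyPositive
      h'.uniformlyNegative h.le_left).1 ?_
    have := h.le_left
    rw [← h'.sup_eq] at this
    rwa [sup_assoc, sup_comm N' P']
  · refine dim_le_of_disjoint (isotropic_sup_disjoint hJ h.le_right h'.uniformlyPositive
      h.uniformlyNegative h'.le_left).2 ?_
    have := h.le_right
    rw [← h'.sup_eq] at this
    rwa [sup_assoc]

/-- The positive signature may be computed from any decomposition. -/
theorem posSignature_eq [CompleteSpace H] {J : H →L[ℂ] H} (hJ : IsSymmetry J)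
    {S Mp Mm : Submodule ℂ H} (h : IsSignatureDecomposition J S Mp Mm) :
    posSignature J S = dim Mp := by
  refine le_antisymm (sInf_le ⟨Mp, Mm, h, rfl⟩) (le_sInf ?_)
  rintro n ⟨P, N, h', rfl⟩
  exact (h.dim_le hJ h').1

/-- The negative signature may be computed from any decomposition. -/
theorem negSignature_eq [CompleteSpace H] {J : H →L[ℂ] H} (hJ : IsSymmetry J)
    {S Mp Mm : Submodule ℂ H} (h : IsSignatureDecomposition J S Mp Mm) :
    negSignature J S = dim Mm := by
  refine le_antisymm (sInf_le ⟨Mp, Mm, h, rfl⟩) (le_sInf ?_)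
  rintro n ⟨P, N, h', rfl⟩
  exact (h.dim_le hJ h').2

end

end Krein

namespace Krein

-- Every `J`-selfadjoint projection can be straightened to a block-diagonal one. For `R = 2E - 1`
-- one has `R² = 1` and `R^# = R`, so conjugation by `J` inverts the positive operator `R* R`, and
-- its logarithm `L` anticommutes with `J`. Hence `exp (t L)` is `J`-unitary for real `t`, and
-- conjugating by `exp (L / 4)` turns `E` into an orthogonal projection commuting with `J`, along a
-- path of `J`-selfadjoint projections (`exists_orthogonal_model`). Such a projection is `diag(e,
-- f)` with respect to the eigenspaces of `J`. The signatures of `R(E)` are the ranks of `e` and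
-- `f`, and the cosignatures are the ranks of `1 - e` and `1 - f` (`IsSplitting.signature_eq`,
-- `IsSplitting.cosignature_eq`).
--
-- In a separable space, rank and corank determine an orthogonal projection up to a unitary, which
-- can be taken in the path component of `1` (`pathConj_of_dim_eq`). Block-diagonal unitaries are
-- `J`-unitary, so equal signatures and cosignatures give both a `J`-unitary conjugation and a path.
--
-- Conversely, these four numbers are invariant under `J`-unitaries, and locally constant in norm
-- (`exists_dim_eq_of_norm_sub_lt`), hence constant on connected components. So the orbit, the
-- component and the class with the same four numbers coincide.

universe u

open scoped InnerProductSpace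

/-! ### The `J`-unitary group, its action, and exponentials -/

open NormedSpace in
-- The adjoint fixes `exp L` because `L` is selfadjoint, and conjugation by `J` passes inside the
-- exponential, where it changes the sign of `L`.
theorem exp_mem_jUnitaries {H : Type*} [NormedAddCommGroup H] [InnerProductSpace ℂ H]
    [CompleteSpace H] {J L : H →L[ℂ] H} (hJ : IsSymmetry J) (hL : IsSelfAdjoint L)
    (hJL : J * L * J = -L) :
    jAdjoint J (exp L) = exp (-L) ∧ exp L ∈ jUnitaries J := by
  let +nondep : NormedAlgebra ℚ (H →L[ℂ] H) := .restrictScalars ℚ ℂ _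
  have h1 : jAdjoint J (exp L) = exp (-L) := by
    unfold jAdjoint
    rw [← ContinuousLinearMap.star_eq_adjoint, star_exp, hL.star_eq, ← hJL]
    exact (exp_units_conj (⟨J, J, hJ.2, hJ.2⟩ : (H →L[ℂ] H)ˣ) L).symm
  have h2 : exp L * exp (-L) = 1 := by
    rw [← exp_add_of_commute (Commute.refl L).neg_right]; simp
  have h3 : exp (-L) * exp L = 1 := by
    rw [← exp_add_of_commute (Commute.refl L).neg_left]; simp
  exact ⟨h1, by rw [h1]; exact h2, by rw [h1]; exact h3⟩

theorem jAdjoint_mul {H : Type*} [NormedAddCommGroup H] [InnerProductSpace ℂ H]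
    [CompleteSpace H] {J : H →L[ℂ] H} (hJ : IsSymmetry J) (S T : H →L[ℂ] H) :
    jAdjoint J (S * T) = jAdjoint J T * jAdjoint J S := by
  have h := hJ.2
  simp only [jAdjoint, ← ContinuousLinearMap.star_eq_adjoint, star_mul]
  calc J * (star T * star S) * J = J * star T * 1 * star S * J := by noncomm_ring
    _ = _ := by rw [← h]; noncomm_ring

theorem jAdjoint_jAdjoint {H : Type*} [NormedAddCommGroup H] [InnerProductSpace ℂ H]
    [CompleteSpace H] {J : H →L[ℂ] H} (hJ : IsSymmetry J) (T : H →L[ℂ] H) :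
    jAdjoint J (jAdjoint J T) = T := by
  have h := hJ.2
  have h' : star J = J := hJ.1
  simp only [jAdjoint, ← ContinuousLinearMap.star_eq_adjoint, star_mul, star_star, h']
  calc J * (J * (T * J)) * J = (J * J) * T * (J * J) := by noncomm_ring
    _ = _ := by rw [h]; simp

theorem jAdjoint_one_sub {H : Type*} [NormedAddCommGroup H] [InnerProductSpace ℂ H]
    [CompleteSpace H] {J : H →L[ℂ] H} (hJ : IsSymmetry J) (T : H →L[ℂ] H) :
    jAdjoint J (1 - T) = 1 - jAdjoint J T := by
  simp only [jAdjoint, ← ContinuousLinearMap.star_eq_adjoint, star_sub, star_one, mul_sub,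
    sub_mul, mul_one, hJ.2]

theorem mul_mem_jUnitaries {H : Type*} [NormedAddCommGroup H] [InnerProductSpace ℂ H]
    [CompleteSpace H] {J U V : H →L[ℂ] H} (hJ : IsSymmetry J) (hU : U ∈ jUnitaries J)
    (hV : V ∈ jUnitaries J) : U * V ∈ jUnitaries J := by
  refine ⟨?_, ?_⟩ <;> rw [jAdjoint_mul hJ]
  · calc U * V * (jAdjoint J V * jAdjoint J U) = U * (V * jAdjoint J V) * jAdjoint J U := by
          noncomm_ring
      _ = 1 := by rw [hV.1, mul_one, hU.1]
  · calc jAdjoint J V * jAdjoint J U * (U * V) = jAdjoint J V * (jAdjoint J U * U) * V := by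
          noncomm_ring
      _ = 1 := by rw [hU.2, mul_one, hV.2]

theorem jAdjoint_mem_jUnitaries {H : Type*} [NormedAddCommGroup H] [InnerProductSpace ℂ H]
    [CompleteSpace H] {J U : H →L[ℂ] H} (hJ : IsSymmetry J) (hU : U ∈ jUnitaries J) :
    jAdjoint J U ∈ jUnitaries J :=
  ⟨by rw [jAdjoint_jAdjoint hJ]; exact hU.2, by rw [jAdjoint_jAdjoint hJ]; exact hU.1⟩

theorem conj_mem_jSelfadjointProjections {H : Type*} [NormedAddCommGroup H]
    [InnerProductSpace ℂ H] [CompleteSpace H] {J U E : H →L[ℂ] H} (hJ : IsSymmetry J)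
    (hU : U ∈ jUnitaries J) (hE : E ∈ jSelfadjointProjections J) :
    U * E * jAdjoint J U ∈ jSelfadjointProjections J := by
  refine ⟨?_, ?_⟩
  · calc U * E * jAdjoint J U * (U * E * jAdjoint J U)
        = U * E * (jAdjoint J U * U) * E * jAdjoint J U := by noncomm_ring
      _ = U * (E * E) * jAdjoint J U := by rw [hU.2]; noncomm_ring
      _ = _ := by rw [hE.1]
  · rw [jAdjoint_mul hJ, jAdjoint_mul hJ, jAdjoint_jAdjoint hJ, hE.2, mul_assoc]

open NormedSpace in
/-- The path `t ↦ exp (t L) E exp (-t L)` stays among the `J`-selfadjoint projections when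
`L` anticommutes with `J`. -/
theorem joinedIn_exp_conj {H : Type*} [NormedAddCommGroup H] [InnerProductSpace ℂ H]
    [CompleteSpace H] {J L E : H →L[ℂ] H} (hJ : IsSymmetry J) (hL : IsSelfAdjoint L)
    (hJL : J * L * J = -L) (hE : E ∈ jSelfadjointProjections J) :
    JoinedIn (jSelfadjointProjections J) E (exp L * E * exp (-L)) := by
  let +nondep : NormedAlgebra ℚ (H →L[ℂ] H) := .restrictScalars ℚ ℂ _
  refine JoinedIn.ofLine (f := fun t : ℝ => exp (t • L) * E * exp (-(t • L))) ?_ ?_ ?_ ?_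
  · have h : Continuous (exp : (H →L[ℂ] H) → _) := exp_continuous
    exact (by fun_prop : Continuous _).continuousOn
  · simp
  · simp
  · rintro _ ⟨t, -, rfl⟩
    have h1 : IsSelfAdjoint (t • L) := by
      rw [isSelfAdjoint_iff, star_smul, hL.star_eq]; simp
    have h2 := exp_mem_jUnitaries hJ h1 (by rw [mul_smul_comm, smul_mul_assoc, hJL, smul_neg])
    have h3 := conj_mem_jSelfadjointProjections hJ h2.2 hE
    rwa [h2.1] at h3

/-! ### Straightening a `J`-selfadjoint projection to an orthogonal one -/

/-- If `R` is an invertible operator that is its own inverse and its own `J`-adjoint, the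
logarithm of `R* R` anticommutes with `J`, and exponentials of its multiples intertwine. -/
theorem exists_log_of_reflection {H : Type*} [NormedAddCommGroup H] [InnerProductSpace ℂ H]
    [CompleteSpace H] {J R : H →L[ℂ] H} (hJ : IsSymmetry J) (hR : R * R = 1)
    (hRJ : jAdjoint J R = R) :
    ∃ L : H →L[ℂ] H, IsSelfAdjoint L ∧ NormedSpace.exp L = star R * R ∧ J * L * J = -L ∧
      Commute (J * R) L := by
  have hJ' : star J = J := hJ.1
  let +nondep : NormedAlgebra ℚ (H →L[ℂ] H) := .restrictScalars ℚ ℂ _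
  have hRR : star R * star R = 1 := by rw [← star_mul, hR, star_one]
  unfold jAdjoint at hRJ
  rw [← ContinuousLinearMap.star_eq_adjoint] at hRJ
  have hJR : J * R = star R * J := by
    calc J * R = J * (J * star R * J) := by rw [hRJ]
      _ = (J * J) * star R * J := by noncomm_ring
      _ = _ := by rw [hJ.2, one_mul]
  have hRJ' : R * J = J * star R := by
    calc R * J = (J * star R * J) * J := by rw [hRJ]
      _ = J * star R * (J * J) := by noncomm_ring
      _ = _ := by rw [hJ.2, mul_one]
  have hunit : IsUnit (star R * R) :=
    ⟨⟨star R * R, R * star R, by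
      calc star R * R * (R * star R) = star R * (R * R) * star R := by noncomm_ring
        _ = 1 := by rw [hR, mul_one, hRR], by
      calc R * star R * (star R * R) = R * (star R * star R) * R := by noncomm_ring
        _ = 1 := by rw [hRR, mul_one, hR]⟩, rfl⟩
  have hpos : IsStrictlyPositive (star R * R) := hunit.isStrictlyPositive (star_mul_self_nonneg R)
  have hexp : NormedSpace.exp (CFC.log (star R * R)) = star R * R := CFC.exp_log _
  have hsa : IsSelfAdjoint (CFC.log (star R * R)) := IsSelfAdjoint.log
  set L := CFC.log (star R * R) with hLdef
  refine ⟨L, hsa, hexp, ?_, ?_⟩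
  · have h1 : NormedSpace.exp (J * L * J) = J * (star R * R) * J := by
      rw [← hexp]
      exact NormedSpace.exp_units_conj (⟨J, J, hJ.2, hJ.2⟩ : (H →L[ℂ] H)ˣ) L
    have h2 : NormedSpace.exp (-L) * NormedSpace.exp L = 1 := by
      rw [← NormedSpace.exp_add_of_commute (Commute.refl L).neg_left]; simp
    -- Both sides equal `R * star R`, the inverse of `star R * R`. Since `log` undoes `exp` on
    -- selfadjoint operators, the exponents then agree.
    have h3 : NormedSpace.exp (J * L * J) = NormedSpace.exp (-L) := by
      rw [h1]
      calc J * (star R * R) * J = (J * star R) * (R * J) := by noncomm_ring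
        _ = R * (J * J) * star R := by rw [← hRJ', hRJ', ← mul_assoc, ← hRJ']; noncomm_ring
        _ = NormedSpace.exp (-L) * NormedSpace.exp L * (R * star R) := by
            rw [hJ.2, h2]; simp
        _ = NormedSpace.exp (-L) * (star R * (R * R) * star R) := by rw [hexp]; noncomm_ring
        _ = _ := by rw [hR, mul_one, hRR, mul_one]
    have h4 : IsSelfAdjoint (J * L * J) := by
      rw [isSelfAdjoint_iff, star_mul, star_mul, hsa.star_eq, hJ', mul_assoc]
    rw [← CFC.log_exp (J * L * J) h4, h3, CFC.log_exp _ hsa.neg]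
  -- `J * R` is selfadjoint with square `star R * R`, so it commutes with functions of `star R * R`.
  · have h1 : Commute (star R * R) (J * R) := by
      change _ * _ = _ * _
      calc star R * R * (J * R) = star R * (R * J) * R := by noncomm_ring
        _ = (star R * J) * (star R * R) := by rw [hRJ']; noncomm_ring
        _ = _ := by rw [hJR]
    exact ((IsSelfAdjoint.star_mul_self R).commute_cfc h1 Real.log).symm

/-- Every `J`-selfadjoint projection is conjugate, under a `J`-unitary, to an orthogonal
projection commuting with `J`, to which it is joined by a path of `J`-selfadjoint projections. -/
theorem exists_orthogonal_model {H : Type*} [NormedAddCommGroup H] [InnerProductSpace ℂ H]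
    [CompleteSpace H] {J E : H →L[ℂ] H} (hJ : IsSymmetry J)
    (hE : E ∈ jSelfadjointProjections J) :
    ∃ U ∈ jUnitaries J, ∃ p : H →L[ℂ] H, IsStarProjection p ∧ Commute J p ∧
      E = U * p * jAdjoint J U ∧ JoinedIn (jSelfadjointProjections J) E p := by
  have hR : (E + E - 1) * (E + E - 1) = 1 := by
    have := hE.1
    noncomm_ring; rw [this]; abel
  have hRJ : jAdjoint J (E + E - 1) = E + E - 1 := by
    have h := hE.2
    unfold jAdjoint at h ⊢
    simp only [map_sub, map_add, mul_sub, sub_mul, mul_add, add_mul, h]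
    rw [← ContinuousLinearMap.star_eq_adjoint, star_one, mul_one, hJ.2]
  obtain ⟨L, hL, hexp, hJL, hcomm⟩ := exists_log_of_reflection hJ hR hRJ
  set R := E + E - 1 with hRdef
  -- With `u = exp M`, the relation `R u⁻¹ = u R` gives `u R u⁻¹ = u² R`. For this to be unitary,
  -- `u⁴` must be `star R * R`, whence the quarter of the logarithm.
  set M := (1 / 4 : ℝ) • L with hM
  have hMsa : IsSelfAdjoint M := by
    rw [isSelfAdjoint_iff, hM, star_smul, hL.star_eq]; simp
  have hJM : J * M * J = -M := by rw [hM, mul_smul_comm, smul_mul_assoc, hJL, smul_neg]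
  have hU := exp_mem_jUnitaries hJ hMsa hJM
  have hJM' : J * -M * J = - -M := by rw [mul_neg, neg_mul, hJM]
  have hUneg := exp_mem_jUnitaries hJ hMsa.neg hJM'
  let +nondep : NormedAlgebra ℚ (H →L[ℂ] H) := .restrictScalars ℚ ℂ _
  set u := NormedSpace.exp M with hu
  set v := NormedSpace.exp (-M) with hv
  have huv : u * v = 1 := by rw [← hU.2.1, hU.1]
  have hvu : v * u = 1 := by rw [← hU.2.2, hU.1]
  have huu : u * u * u * u = star R * R := by
    rw [← hexp, hu, ← NormedSpace.exp_add_of_commute (Commute.refl M),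
      ← NormedSpace.exp_add_of_commute ((Commute.refl M).add_left (Commute.refl M)),
      ← NormedSpace.exp_add_of_commute
        (((Commute.refl M).add_left (Commute.refl M)).add_left (Commute.refl M))]
    congr 1
    rw [hM]; module
  have husa : star u = u := by rw [hu, NormedSpace.star_exp, hMsa.star_eq]
  have hcu : Commute (J * R) u := by
    have : Commute (J * R) M := hcomm.smul_right _
    exact this.exp_right
  have hJu : J * u * J = v := by
    have := hU.1
    rwa [jAdjoint, ← ContinuousLinearMap.star_eq_adjoint, husa] at this
  have hJJ := hJ.2
  -- `R` intertwines `u` with its inverse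
  have hRu : R * u = v * R := by
    calc R * u = J * J * R * u := by rw [hJJ, one_mul]
      _ = J * (J * R * u) := by noncomm_ring
      _ = J * u * (J * R) := by rw [hcu.eq]; noncomm_ring
      _ = _ := by rw [← hJu]; noncomm_ring
  have hRv : R * v = u * R := by
    calc R * v = u * v * (R * v) := by rw [huv, one_mul]
      _ = u * (v * R) * v := by noncomm_ring
      _ = u * R * (u * v) := by rw [← hRu]; noncomm_ring
      _ = _ := by rw [huv, mul_one]
  have hσ : star (u * u * R) * (u * u * R) = 1 := by
    rw [star_mul, star_mul, husa]
    calc star R * (u * u) * (u * u * R) = star R * (u * u * u * u) * R := by noncomm_ring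
      _ = star R * star R * (R * R) := by rw [huu]; noncomm_ring
      _ = 1 := by rw [← star_mul, hR]; simp
  have hσσ : u * u * R * (u * u * R) = 1 := by
    have h : u * u * R = u * R * v := by rw [mul_assoc, mul_assoc u R v, hRv]
    rw [h]
    calc u * R * v * (u * R * v) = u * R * (v * u) * R * v := by noncomm_ring
      _ = u * (R * R) * v := by rw [hvu]; noncomm_ring
      _ = 1 := by rw [hR, mul_one, huv]
  -- A unitary whose square is `1` is selfadjoint.
  have hσsa : star (u * u * R) = u * u * R := by
    calc star (u * u * R) = star (u * u * R) * (u * u * R * (u * u * R)) := by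
          rw [hσσ, mul_one]
      _ = _ := by rw [← mul_assoc, hσ, one_mul]
  have hpσ : u * E * v + u * E * v - 1 = u * u * R := by
    calc u * E * v + u * E * v - 1 = u * (R * v) := by
          rw [hRdef, sub_mul, add_mul, mul_sub, mul_add, one_mul, huv]; simp only [mul_assoc]
      _ = _ := by rw [hRv, mul_assoc]
  have hjoin : JoinedIn (jSelfadjointProjections J) E (u * E * v) :=
    joinedIn_exp_conj hJ hMsa hJM hE
  have hp := hjoin.target_mem
  have hpsa : star (u * E * v) = u * E * v := by
    have h1 : star (u * E * v + u * E * v - 1) = u * E * v + u * E * v - 1 := by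
      rw [hpσ, hσsa]
    rw [star_sub, star_add, star_one, sub_left_inj] at h1
    have h2 : (2 : ℂ) • star (u * E * v) = (2 : ℂ) • (u * E * v) := by
      rw [two_smul, two_smul, h1]
    exact smul_right_injective _ (two_ne_zero) h2
  refine ⟨v, hUneg.2, u * E * v, ⟨hp.1, hpsa⟩, ?_, ?_, hjoin⟩
  · have h := hp.2
    rw [jAdjoint, ← ContinuousLinearMap.star_eq_adjoint, hpsa] at h
    change _ * _ = _ * _
    calc J * (u * E * v) = J * (u * E * v) * (J * J) := by rw [hJJ, mul_one]
      _ = (J * (u * E * v) * J) * J := by noncomm_ring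
      _ = _ := by rw [h]
  · rw [hUneg.1, neg_neg, ← hu]
    calc E = (v * u) * E * (v * u) := by rw [hvu]; simp
      _ = _ := by noncomm_ring

/-! ### Paths of unitaries and path conjugacy in a C⋆-algebra -/

open ContinuousLinearMap

/-- A unitary element of a C⋆-algebra whose spectrum misses a point of the circle is joined to
`1` by a path of unitaries. -/
theorem joined_one_of_notMem_spectrum {A : Type*} [CStarAlgebra A] (u : unitary A) (z : ℂ)
    (hz : ‖z‖ = 1) (hz1 : z ≠ -1) (hzu : -z ∉ spectrum ℂ (u : A)) : Joined 1 u := by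
  rcases subsingleton_or_nontrivial A with hA | hA
  · rw [Subsingleton.elim u 1]
  have hzmem : z ∈ unitary ℂ := by
    rw [Unitary.mem_iff_self_mul_star]
    simp [Complex.mul_conj, Complex.normSq_eq_norm_sq, hz]
  have hz0 : z ≠ 0 := by rintro rfl; simp at hz
  have hv : algebraMap ℂ A z ∈ unitary A := by
    rw [Unitary.mem_iff, ← algebraMap_star_comm, ← map_mul, ← map_mul]
    rw [Unitary.mem_iff] at hzmem
    rw [hzmem.1, hzmem.2, map_one]
    exact ⟨rfl, rfl⟩
  let v : unitary A := ⟨_, hv⟩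
  -- Unitaries at distance less than `2` are joined. The scalar `z` is a stopover: `z ≠ -1` links it
  -- to `1`, and `-z` outside the spectrum of `u` means that `-1` is not in the spectrum of `u *
  -- star z`, which links it to `u`.
  have h1 : Joined 1 v := by
    refine Unitary.joined 1 v ?_
    have : (↑v - ↑(1 : unitary A) : A) = (v : A) - 1 := rfl
    rw [this, Unitary.norm_sub_one_lt_two_iff hv]
    rw [spectrum.scalar_eq]
    simpa using hz1.symm
  have h2 : Joined v u := by
    refine Unitary.joined v u ?_
    rw [Unitary.norm_sub_eq]
    have : (((u * star v : unitary A)) : A) = (star z) • (u : A) := by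
      simp [v, ← algebraMap_star_comm, Algebra.smul_def, Algebra.commutes]
    rw [Unitary.norm_sub_one_lt_two_iff (u * star v).2, this]
    have hs : IsUnit (star z) := by simpa using hz0
    intro hmem
    obtain ⟨w, hw⟩ := hs
    rw [← hw] at hmem
    have : (w : ℂ) • (u : A) = w • (u : A) := rfl
    rw [this, spectrum.unit_smul_eq_smul] at hmem
    obtain ⟨y, hy, hy'⟩ := hmem
    have hy' : star z * y = -1 := by rw [← hw]; exact hy'
    have : y = -z := by
      have h3 : z * star z = 1 := (Unitary.mem_iff.mp hzmem).2
      linear_combination z * hy' - y * h3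
    exact hzu (this ▸ hy)
  exact h1.trans h2

/-- The circle is infinite, so some `z` on it avoids `-1` and the negatives of the spectral values.
-/
theorem joined_one_of_finite_spectrum {A : Type*} [CStarAlgebra A] (u : unitary A)
    (hu : (spectrum ℂ (u : A)).Finite) : Joined 1 u := by
  have hinf : (Metric.sphere (0 : ℂ) 1).Infinite := by
    refine (isPreconnected_sphere (by simp [Complex.rank_real_complex]) 0 1).infinite_of_nontrivial
      ⟨1, by simp, -1, by simp, ?_⟩
    intro h; have := congrArg Complex.re h; norm_num at this
  obtain ⟨z, hz, hz'⟩ := (hinf.sdiff ((hu.image Neg.neg).union (Set.finite_singleton (-1)))).nonempty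
  refine joined_one_of_notMem_spectrum u z (by simpa using hz) ?_ ?_
  · rintro rfl; exact hz' (Or.inr rfl)
  · intro h; exact hz' (Or.inl ⟨-z, h, neg_neg z⟩)

/-- The spectrum lies in `{1, -1}`, so `z = i` works: `(-i - u)(i - u) = 2` is invertible. -/
theorem joined_one_of_mul_self_eq_one {A : Type*} [CStarAlgebra A] (u : unitary A)
    (hu : (u : A) * u = 1) : Joined 1 u := by
  refine joined_one_of_notMem_spectrum u Complex.I (by simp) ?_ ?_
  · intro h; have := congrArg Complex.re h; simp at this
  · rw [spectrum.notMem_iff]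
    have key : (algebraMap ℂ A (-Complex.I) - u) * (algebraMap ℂ A Complex.I - u) =
        algebraMap ℂ A 2 := by
      rw [sub_mul, mul_sub, mul_sub, hu, ← map_mul, ← Algebra.commutes, map_neg]
      rw [show (2 : ℂ) = -Complex.I * Complex.I + 1 by simp; norm_num, map_add, map_one]
      noncomm_ring
    have hc : Commute (algebraMap ℂ A (-Complex.I) - u) (algebraMap ℂ A Complex.I - u) := by
      refine (Commute.sub_left ?_ ?_)
      · exact Algebra.commute_algebraMap_left _ _
      · exact (Algebra.commute_algebraMap_right _ _).sub_right (Commute.refl _)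
    have h2 : IsUnit (algebraMap ℂ A 2) := (IsUnit.mk0 (2 : ℂ) two_ne_zero).map _
    rw [← key] at h2
    exact (hc.isUnit_mul_iff.mp h2).1

/-- Projections `e` and `f` are conjugate by a unitary in the path component of `1`. -/
def PathConj {A : Type*} [CStarAlgebra A] (e f : A) : Prop :=
  ∃ V : unitary A, Joined 1 V ∧ (V : A) * e * star (V : A) = f

theorem PathConj.refl {A : Type*} [CStarAlgebra A] (e : A) : PathConj e e :=
  ⟨1, Joined.refl 1, by simp⟩

theorem PathConj.symm {A : Type*} [CStarAlgebra A] {e f : A} (h : PathConj e f) :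
    PathConj f e := by
  obtain ⟨V, hV, rfl⟩ := h
  refine ⟨V⁻¹, by simpa using hV.inv, ?_⟩
  have h1 : star (V : A) * V = 1 := Unitary.coe_star_mul_self V
  simp only [← Unitary.star_eq_inv, Unitary.coe_star, star_star]
  calc star (V : A) * (V * e * star (V : A)) * V = (star (V : A) * V) * e * (star (V : A) * V) := by
        noncomm_ring
    _ = e := by rw [h1]; simp

theorem PathConj.trans {A : Type*} [CStarAlgebra A] {e f g : A} (h : PathConj e f)
    (h' : PathConj f g) : PathConj e g := by
  obtain ⟨V, hV, rfl⟩ := h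
  obtain ⟨W, hW, rfl⟩ := h'
  refine ⟨W * V, by simpa using hW.mul hV, ?_⟩
  simp [mul_assoc]

theorem PathConj.one_sub {A : Type*} [CStarAlgebra A] {e f : A} (h : PathConj e f) :
    PathConj (1 - e) (1 - f) := by
  obtain ⟨V, hV, rfl⟩ := h
  exact ⟨V, hV, by simp [mul_sub, sub_mul]⟩

/-! ### Path conjugacy from explicit unitaries -/

section Hilbert

variable {K M : Type*} [NormedAddCommGroup K] [InnerProductSpace ℂ K] [CompleteSpace K]
  [NormedAddCommGroup M] [InnerProductSpace ℂ M] [CompleteSpace M]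

theorem adjoint_comp_eq_zero_symm {N : Type*} [NormedAddCommGroup N] [InnerProductSpace ℂ N]
    [CompleteSpace N] {a : M →L[ℂ] K} {b : N →L[ℂ] K} (h : adjoint a ∘L b = 0) :
    adjoint b ∘L a = 0 := by
  have := congrArg adjoint h
  simpa [adjoint_comp] using this

/-- Ranges of isometries with orthogonal ranges are exchanged by a symmetry. -/
theorem pathConj_of_orthogonal_isometries {a b : M →L[ℂ] K} (ha : adjoint a ∘L a = 1)
    (hb : adjoint b ∘L b = 1) (hab : adjoint a ∘L b = 0) :
    PathConj (a ∘L adjoint a) (b ∘L adjoint b) := by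
  have hba := adjoint_comp_eq_zero_symm hab
  have ha' : ∀ x, adjoint a (a x) = x := fun x => DFunLike.congr_fun ha x
  have hb' : ∀ x, adjoint b (b x) = x := fun x => DFunLike.congr_fun hb x
  have hab' : ∀ x, adjoint a (b x) = 0 := fun x => DFunLike.congr_fun hab x
  have hba' : ∀ x, adjoint b (a x) = 0 := fun x => DFunLike.congr_fun hba x
  -- `s` exchanges `a x` and `b x` and is the identity on the orthogonal complement of both ranges.
  set s : K →L[ℂ] K := b ∘L adjoint a + a ∘L adjoint b + 1 - a ∘L adjoint a - b ∘L adjoint b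
    with hs
  have hsa : star s = s := by
    rw [star_eq_adjoint, hs]
    simp only [map_sub, map_add, adjoint_comp, adjoint_adjoint]
    rw [← star_eq_adjoint, star_one]
    abel
  have hss : s * s = 1 := by
    ext x
    simp [hs, ha', hb', hab', hba']
    abel
  refine ⟨⟨s, by rw [Unitary.mem_iff, hsa]; exact ⟨hss, hss⟩⟩,
    joined_one_of_mul_self_eq_one _ hss, ?_⟩
  change s * _ * star s = _
  rw [hsa]
  ext x
  simp [hs, ha', hab', hba']

/-- In finite dimensions, unitarily equivalent projections are path conjugate. -/
theorem pathConj_of_finiteDimensional [FiniteDimensional ℂ K] {e : K →L[ℂ] K}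
    (V : unitary (K →L[ℂ] K)) : PathConj e ((V : K →L[ℂ] K) * e * star (V : K →L[ℂ] K)) := by
  refine ⟨V, joined_one_of_finite_spectrum V ?_, rfl⟩
  have h := Module.End.finite_spectrum ((V : K →L[ℂ] K) : K →ₗ[ℂ] K)
  let φ : (K →L[ℂ] K) ≃ₐ[ℂ] Module.End ℂ K :=
    AlgEquiv.ofLinearEquiv (LinearMap.toContinuousLinearMap (𝕜 := ℂ) (E := K) (F' := K)).symm rfl
      (fun _ _ => rfl)
  have h2 := AlgEquiv.spectrum_eq φ (V : K →L[ℂ] K)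
  rw [← h2]
  exact h

end Hilbert

/-! ### Orthonormal families in separable and in infinite-dimensional spaces -/

/-- Orthonormal vectors are at mutual distance `√2`, so balls of radius `1/2` around them are
disjoint. -/
theorem countable_of_orthonormal {K : Type*} [NormedAddCommGroup K] [InnerProductSpace ℂ K]
    [TopologicalSpace.SeparableSpace K] {ι : Type*} {v : ι → K}
    (hv : Orthonormal ℂ v) : Countable ι := by
  refine Pairwise.countable_of_isOpen_disjoint (s := fun i => Metric.ball (v i) (1 / 2))
    ?_ (fun _ => Metric.isOpen_ball) (fun i => ⟨v i, by simp⟩)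
  intro i j hij
  refine Metric.ball_disjoint_ball ?_
  have h : ‖v i - v j‖ ^ 2 = 2 := by
    rw [@norm_sub_sq ℂ, hv.inner_eq_zero hij, hv.norm_eq_one, hv.norm_eq_one]
    norm_num
  rw [dist_eq_norm]
  nlinarith [norm_nonneg (v i - v j)]

/-- Pairing with the finitely many vectors of `F` maps `S` linearly to a finite-dimensional space,
so the map has a nonzero kernel. -/
theorem exists_unit_vector_orthogonal {K : Type*} [NormedAddCommGroup K]
    [InnerProductSpace ℂ K] {S : Submodule ℂ K} (hS : ¬ FiniteDimensional ℂ S)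
    (F : Finset K) : ∃ x ∈ S, ‖x‖ = 1 ∧ ∀ y ∈ F, ⟪y, x⟫_ℂ = 0 := by
  let T : S →ₗ[ℂ] (F → ℂ) := LinearMap.pi fun y => ((innerSL ℂ (y : K) : K →ₗ[ℂ] ℂ)) ∘ₗ S.subtype
  have hT : ¬ Function.Injective T := fun h => hS (FiniteDimensional.of_injective T h)
  rw [← LinearMap.ker_eq_bot, Submodule.eq_bot_iff] at hT
  push Not at hT
  obtain ⟨x, hx, hx0⟩ := hT
  have hx0' : (x : K) ≠ 0 := by simpa using hx0
  have hn : ‖(x : K)‖ ≠ 0 := norm_ne_zero_iff.mpr hx0'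
  refine ⟨((‖(x : K)‖⁻¹ : ℝ) : ℂ) • (x : K), S.smul_mem _ x.2, ?_, fun y hy => ?_⟩
  · rw [norm_smul]; simp [hn]
  · have h1 : T x ⟨y, hy⟩ = 0 := by rw [LinearMap.mem_ker.mp hx]; rfl
    rw [inner_smul_right]
    have h2 : ⟪y, (x : K)⟫_ℂ = 0 := h1
    rw [h2, mul_zero]

/-- Two infinite dimensional subspaces contain mutually orthogonal orthonormal sequences. -/
theorem exists_orthonormal_sequences {K : Type*} [NormedAddCommGroup K]
    [InnerProductSpace ℂ K] {S T : Submodule ℂ K} (hS : ¬ FiniteDimensional ℂ S)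
    (hT : ¬ FiniteDimensional ℂ T) :
    ∃ c d : ℕ → K, Orthonormal ℂ c ∧ Orthonormal ℂ d ∧ (∀ n, c n ∈ S) ∧ (∀ n, d n ∈ T) ∧
      ∀ m n, ⟪c m, d n⟫_ℂ = 0 := by
  classical
  have : Std.Symm (fun x y : K × K => ⟪x.1, y.1⟫_ℂ = 0 ∧ ⟪x.1, y.2⟫_ℂ = 0 ∧
      ⟪x.2, y.1⟫_ℂ = 0 ∧ ⟪x.2, y.2⟫_ℂ = 0) :=
    ⟨fun x y ⟨h1, h2, h3, h4⟩ => ⟨inner_eq_zero_symm.mp h1, inner_eq_zero_symm.mp h3,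
      inner_eq_zero_symm.mp h2, inner_eq_zero_symm.mp h4⟩⟩
  -- Both sequences are built together as one sequence of pairs. Orthogonality within a pair is part
  -- of the predicate, and orthogonality between different pairs is the symmetric relation.
  obtain ⟨f, hf, hf'⟩ := exists_seq_of_forall_finset_exists'
    (fun x : K × K => x.1 ∈ S ∧ x.2 ∈ T ∧ ‖x.1‖ = 1 ∧ ‖x.2‖ = 1 ∧ ⟪x.1, x.2⟫_ℂ = 0)
    (fun x y => ⟪x.1, y.1⟫_ℂ = 0 ∧ ⟪x.1, y.2⟫_ℂ = 0 ∧ ⟪x.2, y.1⟫_ℂ = 0 ∧ ⟪x.2, y.2⟫_ℂ = 0)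
    (by
      intro s _
      obtain ⟨x, hxS, hx1, hx⟩ := exists_unit_vector_orthogonal hS
        (s.image Prod.fst ∪ s.image Prod.snd)
      obtain ⟨y, hyT, hy1, hy⟩ := exists_unit_vector_orthogonal hT
        (insert x (s.image Prod.fst ∪ s.image Prod.snd))
      refine ⟨(x, y), ⟨hxS, hyT, hx1, hy1, hy x (Finset.mem_insert_self _ _)⟩, fun z hz => ?_⟩
      have h1 : z.1 ∈ s.image Prod.fst ∪ s.image Prod.snd :=
        Finset.mem_union_left _ (Finset.mem_image_of_mem _ hz)
      have h2 : z.2 ∈ s.image Prod.fst ∪ s.image Prod.snd :=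
        Finset.mem_union_right _ (Finset.mem_image_of_mem _ hz)
      exact ⟨hx _ h1, hy _ (Finset.mem_insert_of_mem h1), hx _ h2,
        hy _ (Finset.mem_insert_of_mem h2)⟩)
  refine ⟨fun n => (f n).1, fun n => (f n).2, ⟨fun n => (hf n).2.2.1, fun m n h => (hf' h).1⟩,
    ⟨fun n => (hf n).2.2.2.1, fun m n h => (hf' h).2.2.2⟩, fun n => (hf n).1, fun n => (hf n).2.1,
    fun m n => ?_⟩
  by_cases h : m = n
  · subst h; exact (hf m).2.2.2.2
  · exact (hf' h).2.1

/-! ### Orthogonal projections of equal rank and corank -/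

section Hilbert

variable {K : Type*} [NormedAddCommGroup K] [InnerProductSpace ℂ K] [CompleteSpace K]

/-- The isometry `ℓ²(ι) → K` that sends the standard basis to an orthonormal family. -/
theorem exists_isometry_of_orthonormal {ι : Type*} {v : ι → K} (hv : Orthonormal ℂ v) :
    ∃ a : lp (fun _ : ι => ℂ) 2 →L[ℂ] K, adjoint a ∘L a = 1 ∧
      ∀ y, adjoint a y = 0 ↔ ∀ i, ⟪v i, y⟫_ℂ = 0 := by
  classical
  let a := hv.orthogonalFamily.linearIsometry.toContinuousLinearMap
  have hcoord : ∀ (y : K) (i : ι), (adjoint a y : ι → ℂ) i = ⟪v i, y⟫_ℂ := by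
    intro y i
    have h1 : a (lp.single 2 i (1 : ℂ)) = v i := by
      simp [a, LinearIsometry.coe_toContinuousLinearMap]
    rw [← h1, ← adjoint_inner_right, lp.inner_single_left]
    simp
  refine ⟨a, ?_, fun y => ?_⟩
  · ext x : 1
    refine ext_inner_right ℂ fun y => ?_
    rw [comp_apply, adjoint_inner_left]
    exact hv.orthogonalFamily.linearIsometry.inner_map_map x y
  · rw [lp.ext_iff, funext_iff]
    exact forall_congr' fun i => by rw [hcoord]; rfl

theorem adjoint_comp_eq_zero_of_inner {ι κ : Type*} {v : ι → K} {w : κ → K}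
    {a : lp (fun _ : ι => ℂ) 2 →L[ℂ] K} {b : lp (fun _ : κ => ℂ) 2 →L[ℂ] K}
    (ha : ∀ y, adjoint a y = 0 ↔ ∀ i, ⟪v i, y⟫_ℂ = 0)
    (hb : ∀ y, adjoint b y = 0 ↔ ∀ i, ⟪w i, y⟫_ℂ = 0)
    (h : ∀ i j, ⟪v i, w j⟫_ℂ = 0) : adjoint a ∘L b = 0 := by
  ext x : 1
  rw [comp_apply, zero_apply, ha]
  intro i
  rw [← adjoint_inner_left, (hb (v i)).mpr, inner_zero_left]
  intro j
  rw [← inner_conj_symm, h, map_zero]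

theorem inner_apply_left_of_isStarProjection {e : K →L[ℂ] K} (he : IsStarProjection e) (x y : K) :
    ⟪e x, y⟫_ℂ = ⟪x, e y⟫_ℂ := by
  rw [← adjoint_inner_right, ← star_eq_adjoint, he.isSelfAdjoint.star_eq]

theorem apply_apply_of_isStarProjection {e : K →L[ℂ] K} (he : IsStarProjection e) (x : K) :
    e (e x) = e x := DFunLike.congr_fun he.isIdempotentElem x

/-- If `v` is an orthonormal basis of the range of the projection `e`, then `e = a a*`. -/
theorem comp_adjoint_eq_of_total {ι : Type*} {v : ι → K} {a : lp (fun _ : ι => ℂ) 2 →L[ℂ] K}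
    {e : K →L[ℂ] K} (he : IsStarProjection e) (ha1 : adjoint a ∘L a = 1)
    (ha : ∀ y, adjoint a y = 0 ↔ ∀ i, ⟪v i, y⟫_ℂ = 0) (hv : ∀ i, e (v i) = v i)
    (htot : ∀ y, e y = y → (∀ i, ⟪v i, y⟫_ℂ = 0) → y = 0) : a ∘L adjoint a = e := by
  have h1 : ∀ y, adjoint a (e y) = adjoint a y := by
    intro y
    rw [← sub_eq_zero, ← map_sub, ha]
    intro i
    rw [inner_sub_right, ← inner_apply_left_of_isStarProjection he, hv, sub_self]
  have h2 : ∀ x, e (a x) = a x := by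
    intro x
    refine ext_inner_right ℂ fun y => ?_
    rw [inner_apply_left_of_isStarProjection he, ← adjoint_inner_right, h1, adjoint_inner_right]
  ext x
  symm
  -- `e x - a (adjoint a x)` lies in the range of `e` and is orthogonal to every `v i`.
  rw [← sub_eq_zero]
  refine htot _ ?_ ((ha _).mp ?_)
  · rw [map_sub, apply_apply_of_isStarProjection he, comp_apply, h2]
  · rw [map_sub, h1, comp_apply, sub_eq_zero]
    exact (DFunLike.congr_fun ha1 (adjoint a x)).symm

theorem isClosed_range_of_isStarProjection {e : K →L[ℂ] K} (he : IsStarProjection e) :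
    IsClosed (LinearMap.range (e : K →ₗ[ℂ] K) : Set K) :=
  IsIdempotentElem.isClosed_range he.isIdempotentElem

/-- An orthonormal basis of the range of a projection, whose cardinality is the dimension. -/
theorem exists_orthonormal_basis_range [TopologicalSpace.SeparableSpace K] {e : K →L[ℂ] K}
    (he : IsStarProjection e) :
    ∃ (w : Set K), Countable w ∧ Orthonormal ℂ (Subtype.val : w → K) ∧ (∀ i : w, e i = i) ∧
      (∀ y, e y = y → (∀ i : w, ⟪(i : K), y⟫_ℂ = 0) → y = 0) ∧
      ENat.card w = dim (LinearMap.range (e : K →ₗ[ℂ] K)) := by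
  set R := LinearMap.range (e : K →ₗ[ℂ] K) with hR
  have hmem : ∀ y, y ∈ R ↔ e y = y := by
    intro y
    refine ⟨?_, fun h => ⟨y, h⟩⟩
    rintro ⟨x, rfl⟩
    exact apply_apply_of_isStarProjection he x
  have : CompleteSpace R := (isClosed_range_of_isStarProjection he).completeSpace_coe
  obtain ⟨w, b, hb⟩ := exists_hilbertBasis ℂ R
  have hbo : Orthonormal ℂ (fun i : w => ((i : R) : K)) := by
    have := b.orthonormal.comp_linearIsometry R.subtypeₗᵢ
    rw [hb] at this
    exact this
  have hcard : ENat.card w = Cardinal.toENat (Module.rank ℂ R) := by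
    by_cases hfin : Finite w
    · have := Fintype.ofFinite w
      rw [rank_eq_card_basis b.toOrthonormalBasis.toBasis]
      simp
    -- The algebraic dimension may exceed the cardinality of a Hilbert basis, but in `ℕ∞` both
    -- become `⊤`.
    · have hinf : Infinite w := not_finite_iff_infinite.mp hfin
      rw [ENat.card_eq_top_of_infinite, eq_comm, Cardinal.toENat_eq_top]
      exact (Cardinal.aleph0_le_mk w).trans b.orthonormal.linearIndependent.cardinal_le_rank
  have hc : Countable w := countable_of_orthonormal hbo
  have hinj : Function.Injective (fun i : w => ((i : R) : K)) :=
    Subtype.val_injective.comp Subtype.val_injective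
  refine ⟨Set.range (fun i : w => ((i : R) : K)), (Set.countable_range _).to_subtype,
    hbo.toSubtypeRange, ?_, ?_, ?_⟩
  · rintro ⟨_, i, rfl⟩
    exact (hmem _).mp i.1.2
  · intro y hy h
    have h0 : b.repr ⟨y, (hmem y).mpr hy⟩ = 0 := by
      ext i
      rw [b.repr_apply_apply, hb]
      exact h ⟨_, i, rfl⟩
    have := (LinearIsometryEquiv.map_eq_zero_iff b.repr).mp h0
    exact congrArg Subtype.val this
  · rw [dim, ← hcard]
    exact (ENat.card_congr (Equiv.ofInjective _ hinj)).symm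

/-- Separability acts here: all infinite index sets are countable, so the value `⊤` determines them
up to bijection. -/
theorem nonempty_equiv_of_encard_eq {α β : Type*} [Countable α] [Countable β]
    (h : ENat.card α = ENat.card β) : Nonempty (α ≃ β) := by
  by_cases hα : Finite α
  · have hβ : Finite β := by
      rw [← ENat.card_lt_top, ← h]
      exact ENat.card_lt_top.mpr hα
    refine Finite.card_eq.mp ?_
    rwa [ENat.card_eq_coe_natCard, ENat.card_eq_coe_natCard, Nat.cast_inj] at h
  · have hi : Infinite α := not_finite_iff_infinite.mp hα
    have hj : Infinite β := by
      rw [← not_finite_iff_infinite, ← ENat.card_lt_top, ← h, ENat.card_eq_top_of_infinite]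
      simp
    exact nonempty_equiv_of_countable

/-- Projections of the same rank are ranges of isometries from a common space `ℓ²(ι)`. -/
theorem exists_isometries_of_dim_eq [TopologicalSpace.SeparableSpace K] {e f : K →L[ℂ] K}
    (he : IsStarProjection e) (hf : IsStarProjection f)
    (h : dim (LinearMap.range (e : K →ₗ[ℂ] K)) = dim (LinearMap.range (f : K →ₗ[ℂ] K))) :
    ∃ (w : Set K) (_ : Countable w) (v v' : w → K) (a b : lp (fun _ : w => ℂ) 2 →L[ℂ] K),
      (∀ i, e (v i) = v i) ∧ (∀ i, f (v' i) = v' i) ∧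
      (∀ y, adjoint a y = 0 ↔ ∀ i, ⟪v i, y⟫_ℂ = 0) ∧
      (∀ y, adjoint b y = 0 ↔ ∀ i, ⟪v' i, y⟫_ℂ = 0) ∧
      adjoint a ∘L a = 1 ∧ adjoint b ∘L b = 1 ∧ a ∘L adjoint a = e ∧ b ∘L adjoint b = f := by
  obtain ⟨w, hw, ho, hev, htot, hcard⟩ := exists_orthonormal_basis_range he
  obtain ⟨w', hw', ho', hev', htot', hcard'⟩ := exists_orthonormal_basis_range hf
  obtain ⟨g⟩ := nonempty_equiv_of_encard_eq (hcard.trans (h.trans hcard'.symm))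
  have hog : Orthonormal ℂ (fun i : w => ((g i : w') : K)) := ho'.comp g g.injective
  obtain ⟨a, ha1, ha⟩ := exists_isometry_of_orthonormal ho
  obtain ⟨b, hb1, hb⟩ := exists_isometry_of_orthonormal hog
  refine ⟨w, hw, _, _, a, b, hev, fun i => hev' _, ha, hb, ha1, hb1,
    comp_adjoint_eq_of_total he ha1 ha hev htot,
    comp_adjoint_eq_of_total hf hb1 hb (fun i => hev' _) fun y hy h => htot' y hy fun i => ?_⟩
  simpa using h (g.symm i)

theorem inner_eq_zero_of_range_one_sub {e : K →L[ℂ] K} (he : IsStarProjection e) {x y : K}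
    (hx : e x = x) (hy : y ∈ LinearMap.range ((1 - e : K →L[ℂ] K) : K →ₗ[ℂ] K)) :
    ⟪x, y⟫_ℂ = 0 := by
  obtain ⟨z, rfl⟩ := hy
  rw [← hx, inner_apply_left_of_isStarProjection he]
  simp [apply_apply_of_isStarProjection he]

/-- Projections of the same rank and of infinite corank are path conjugate. -/
theorem pathConj_of_infinite_corank [TopologicalSpace.SeparableSpace K] {e f : K →L[ℂ] K}
    (he : IsStarProjection e) (hf : IsStarProjection f)
    (h : dim (LinearMap.range (e : K →ₗ[ℂ] K)) = dim (LinearMap.range (f : K →ₗ[ℂ] K)))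
    (he' : ¬ FiniteDimensional ℂ (LinearMap.range ((1 - e : K →L[ℂ] K) : K →ₗ[ℂ] K)))
    (hf' : ¬ FiniteDimensional ℂ (LinearMap.range ((1 - f : K →L[ℂ] K) : K →ₗ[ℂ] K))) :
    PathConj e f := by
  obtain ⟨w, hw, v, v', a, b, hv, hv', ha, hb, ha1, hb1, hae, hbf⟩ :=
    exists_isometries_of_dim_eq he hf h
  -- The ranges of `e` and `f` may be in general position, so two intermediate projections are
  -- inserted: one onto a copy inside `ker e`, one onto a copy inside `ker f`, orthogonal to each
  -- other. Each of the three moves is between orthogonal ranges.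
  obtain ⟨c, d, hc, hd, hcS, hdT, hcd⟩ := exists_orthonormal_sequences he' hf'
  obtain ⟨g, hg⟩ := Countable.exists_injective_nat w
  obtain ⟨γ, hγ1, hγ⟩ := exists_isometry_of_orthonormal (hc.comp g hg)
  obtain ⟨δ, hδ1, hδ⟩ := exists_isometry_of_orthonormal (hd.comp g hg)
  have h1 := pathConj_of_orthogonal_isometries ha1 hγ1 (adjoint_comp_eq_zero_of_inner ha hγ
    fun i j => inner_eq_zero_of_range_one_sub he (hv i) (hcS _))
  have h2 := pathConj_of_orthogonal_isometries hγ1 hδ1 (adjoint_comp_eq_zero_of_inner hγ hδ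
    fun i j => hcd _ _)
  have h3 := pathConj_of_orthogonal_isometries hb1 hδ1 (adjoint_comp_eq_zero_of_inner hb hδ
    fun i j => inner_eq_zero_of_range_one_sub hf (hv' i) (hdT _))
  rw [hae] at h1
  rw [hbf] at h3
  exact (h1.trans h2).trans h3.symm

theorem adjoint_comp_eq_zero_of_mul {M N : Type*} [NormedAddCommGroup M] [InnerProductSpace ℂ M]
    [CompleteSpace M] [NormedAddCommGroup N] [InnerProductSpace ℂ N] [CompleteSpace N]
    {a : M →L[ℂ] K} {b : N →L[ℂ] K} (ha : adjoint a ∘L a = 1) (hb : adjoint b ∘L b = 1)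
    (h : (a ∘L adjoint a) * (b ∘L adjoint b) = 0) : adjoint a ∘L b = 0 := by
  ext x
  have h1 := congrArg (adjoint a) (DFunLike.congr_fun h (b x))
  have ha' : ∀ x, adjoint a (a x) = x := fun x => DFunLike.congr_fun ha x
  have hb' : ∀ x, adjoint b (b x) = x := fun x => DFunLike.congr_fun hb x
  simpa [ha', hb'] using h1

/-- Projections of the same rank and corank are unitarily equivalent. -/
theorem exists_unitary_conj [TopologicalSpace.SeparableSpace K] {e f : K →L[ℂ] K}
    (he : IsStarProjection e) (hf : IsStarProjection f)
    (h : dim (LinearMap.range (e : K →ₗ[ℂ] K)) = dim (LinearMap.range (f : K →ₗ[ℂ] K)))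
    (h' : dim (LinearMap.range ((1 - e : K →L[ℂ] K) : K →ₗ[ℂ] K)) =
      dim (LinearMap.range ((1 - f : K →L[ℂ] K) : K →ₗ[ℂ] K))) :
    ∃ V : unitary (K →L[ℂ] K), (V : K →L[ℂ] K) * e * star (V : K →L[ℂ] K) = f := by
  obtain ⟨w, hw, v, v', a, b, -, -, -, -, ha1, hb1, hae, hbf⟩ :=
    exists_isometries_of_dim_eq he hf h
  obtain ⟨w', hw', -, -, a', b', -, -, -, -, ha1', hb1', hae', hbf'⟩ :=
    exists_isometries_of_dim_eq he.one_sub hf.one_sub h'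
  have hz1 : adjoint a ∘L a' = 0 := adjoint_comp_eq_zero_of_mul ha1 ha1'
    (by rw [hae, hae']; exact he.mul_one_sub_self)
  have hz2 : adjoint b ∘L b' = 0 := adjoint_comp_eq_zero_of_mul hb1 hb1'
    (by rw [hbf, hbf']; exact hf.mul_one_sub_self)
  have hz1' := adjoint_comp_eq_zero_symm hz1
  have hz2' := adjoint_comp_eq_zero_symm hz2
  have e1 : ∀ x, adjoint a (a x) = x := fun x => DFunLike.congr_fun ha1 x
  have e2 : ∀ x, adjoint b (b x) = x := fun x => DFunLike.congr_fun hb1 x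
  have e3 : ∀ x, adjoint a' (a' x) = x := fun x => DFunLike.congr_fun ha1' x
  have e4 : ∀ x, adjoint b' (b' x) = x := fun x => DFunLike.congr_fun hb1' x
  have e5 : ∀ x, adjoint a (a' x) = 0 := fun x => DFunLike.congr_fun hz1 x
  have e6 : ∀ x, adjoint b (b' x) = 0 := fun x => DFunLike.congr_fun hz2 x
  have e7 : ∀ x, adjoint a' (a x) = 0 := fun x => DFunLike.congr_fun hz1' x
  have e8 : ∀ x, adjoint b' (b x) = 0 := fun x => DFunLike.congr_fun hz2' x
  have e9 : ∀ x, a (adjoint a x) + a' (adjoint a' x) = x := fun x => by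
    have := DFunLike.congr_fun (congrArg₂ (· + ·) hae hae') x
    simpa using this
  have e10 : ∀ x, b (adjoint b x) + b' (adjoint b' x) = x := fun x => by
    have := DFunLike.congr_fun (congrArg₂ (· + ·) hbf hbf') x
    simpa using this
  -- `V` carries the range of `e` to that of `f` by `a x ↦ b x`, and likewise the complements by `a'
  -- x ↦ b' x`.
  set V : K →L[ℂ] K := b ∘L adjoint a + b' ∘L adjoint a' with hV
  have hVs : star V = a ∘L adjoint b + a' ∘L adjoint b' := by
    rw [star_eq_adjoint, hV]
    simp [adjoint_comp]
  refine ⟨⟨V, ?_⟩, ?_⟩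
  · rw [Unitary.mem_iff, hVs]
    constructor
    · ext x; simp [hV, e2, e4, e6, e8, e9]
    · ext x; simp [hV, e1, e3, e5, e7, e10]
  · change V * e * star V = f
    rw [hVs, ← hae, ← hbf]
    ext x
    simp [hV, e1, e5, e7]

/-- Projections of the same rank and corank are path conjugate. -/
theorem pathConj_of_dim_eq [TopologicalSpace.SeparableSpace K] {e f : K →L[ℂ] K}
    (he : IsStarProjection e) (hf : IsStarProjection f)
    (h : dim (LinearMap.range (e : K →ₗ[ℂ] K)) = dim (LinearMap.range (f : K →ₗ[ℂ] K)))
    (h' : dim (LinearMap.range ((1 - e : K →L[ℂ] K) : K →ₗ[ℂ] K)) =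
      dim (LinearMap.range ((1 - f : K →L[ℂ] K) : K →ₗ[ℂ] K))) : PathConj e f := by
  have hfin : ∀ S T : Submodule ℂ K, dim S = dim T → FiniteDimensional ℂ T →
      FiniteDimensional ℂ S := by
    intro S T hST hT
    rw [FiniteDimensional, ← Module.rank_lt_aleph0_iff, ← Cardinal.toENat_lt_top] at hT ⊢
    unfold dim at hST
    rwa [hST]
  by_cases hK : FiniteDimensional ℂ K
  · obtain ⟨V, rfl⟩ := exists_unitary_conj he hf h h'
    exact pathConj_of_finiteDimensional V
  -- If the corank is finite in an infinite-dimensional space, then the rank is infinite and the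
  -- infinite-corank case applies to `1 - e` and `1 - f`.
  by_cases h1 : FiniteDimensional ℂ (LinearMap.range ((1 - e : K →L[ℂ] K) : K →ₗ[ℂ] K))
  · have h2 : ¬ FiniteDimensional ℂ (LinearMap.range (e : K →ₗ[ℂ] K)) := by
      intro h2
      refine hK ?_
      have htop : LinearMap.range (e : K →ₗ[ℂ] K) ⊔
          LinearMap.range ((1 - e : K →L[ℂ] K) : K →ₗ[ℂ] K) = ⊤ := by
        rw [eq_top_iff]
        intro x _
        have : x = e x + (1 - e) x := by simp
        rw [this]
        exact Submodule.add_mem_sup ⟨x, rfl⟩ ⟨x, rfl⟩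
      have h3 : FiniteDimensional ℂ (⊤ : Submodule ℂ K) := by
        rw [← htop]; infer_instance
      exact Module.finite_def.mpr (Module.Finite.iff_fg.mp h3)
    have h3 := pathConj_of_infinite_corank he.one_sub hf.one_sub h' (by rwa [sub_sub_cancel])
      (by rw [sub_sub_cancel]; exact fun h3 => h2 (hfin _ _ h h3))
    simpa using h3.one_sub
  · exact pathConj_of_infinite_corank he hf h h1 fun h3 => h1 (hfin _ _ h' h3)

end Hilbert

theorem _root_.IsStarProjection.unitary_conj {A : Type*} [Ring A] [StarRing A] {e : A}
    (he : IsStarProjection e) (V : unitary A) : IsStarProjection ((V : A) * e * star (V : A)) := by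
  constructor
  · change (V : A) * e * star (V : A) * ((V : A) * e * star (V : A)) = _
    calc (V : A) * e * star (V : A) * ((V : A) * e * star (V : A))
        = (V : A) * e * (star (V : A) * (V : A)) * e * star (V : A) := by noncomm_ring
      _ = (V : A) * (e * e) * star (V : A) := by
          rw [Unitary.coe_star_mul_self]; noncomm_ring
      _ = _ := by rw [he.isIdempotentElem.eq]
  · rw [isSelfAdjoint_iff]
    simp [he.isSelfAdjoint.star_eq, mul_assoc]

/-! ### Block-diagonal operators over the eigenspaces of `J` -/

section Splitting

variable {H P N : Type u} [NormedAddCommGroup H] [InnerProductSpace ℂ H] [CompleteSpace H]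
  [NormedAddCommGroup P] [InnerProductSpace ℂ P] [CompleteSpace P]
  [NormedAddCommGroup N] [InnerProductSpace ℂ N] [CompleteSpace N]

/-- `i` and `j` are isometries onto the eigenspaces of `J` for the eigenvalues `1` and `-1`. -/
structure IsSplitting (J : H →L[ℂ] H) (i : P →L[ℂ] H) (j : N →L[ℂ] H) : Prop where
  left : ∀ x, adjoint i (i x) = x
  right : ∀ x, adjoint j (j x) = x
  left_right : ∀ x, adjoint i (j x) = 0
  right_left : ∀ x, adjoint j (i x) = 0
  sum : ∀ x, i (adjoint i x) + j (adjoint j x) = x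
  apply_left : ∀ x, J (i x) = i x
  apply_right : ∀ x, J (j x) = -j x

/-- The operator on `H` with diagonal blocks `A` and `B`. -/
noncomputable def blockDiag (i : P →L[ℂ] H) (j : N →L[ℂ] H) (A : P →L[ℂ] P) (B : N →L[ℂ] N) :
    H →L[ℂ] H :=
  i ∘L A ∘L adjoint i + j ∘L B ∘L adjoint j

variable {J : H →L[ℂ] H} {i : P →L[ℂ] H} {j : N →L[ℂ] H}

theorem IsSplitting.blockDiag_mul (h : IsSplitting J i j) (A A' : P →L[ℂ] P) (B B' : N →L[ℂ] N) :
    blockDiag i j A B * blockDiag i j A' B' = blockDiag i j (A * A') (B * B') := by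
  ext x
  simp [blockDiag, h.left, h.right, h.left_right, h.right_left]

theorem IsSplitting.blockDiag_one (h : IsSplitting J i j) : blockDiag i j 1 1 = 1 := by
  ext x
  simp [blockDiag, h.sum]

theorem IsSplitting.blockDiag_eq_symmetry (h : IsSplitting J i j) : J = blockDiag i j 1 (-1) := by
  ext x
  conv_lhs => rw [← h.sum x]
  simp [blockDiag, h.apply_left, h.apply_right]

theorem blockDiag_sub (A A' : P →L[ℂ] P) (B B' : N →L[ℂ] N) :
    blockDiag i j (A - A') (B - B') = blockDiag i j A B - blockDiag i j A' B' := by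
  ext x
  simp [blockDiag]
  abel

theorem star_blockDiag (A : P →L[ℂ] P) (B : N →L[ℂ] N) :
    star (blockDiag i j A B) = blockDiag i j (star A) (star B) := by
  simp [blockDiag, star_eq_adjoint, adjoint_comp, comp_assoc]

/-- `J = diag(1, -1)` commutes with block-diagonal operators, so on them the `J`-adjoint is the
Hilbert adjoint. -/
theorem IsSplitting.jAdjoint_blockDiag (h : IsSplitting J i j) (A : P →L[ℂ] P) (B : N →L[ℂ] N) :
    jAdjoint J (blockDiag i j A B) = blockDiag i j (star A) (star B) := by
  unfold jAdjoint
  rw [← star_eq_adjoint, star_blockDiag]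
  nth_rewrite 1 [h.blockDiag_eq_symmetry]
  nth_rewrite 1 [h.blockDiag_eq_symmetry]
  rw [h.blockDiag_mul, h.blockDiag_mul]
  simp

theorem IsSplitting.blockDiag_mem_jUnitaries (h : IsSplitting J i j) (V : unitary (P →L[ℂ] P))
    (W : unitary (N →L[ℂ] N)) :
    blockDiag i j (V : P →L[ℂ] P) (W : N →L[ℂ] N) ∈ jUnitaries J := by
  constructor <;> rw [h.jAdjoint_blockDiag, h.blockDiag_mul] <;> simp [h.blockDiag_one]

theorem IsSplitting.blockDiag_mem_jSelfadjointProjections (h : IsSplitting J i j)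
    {e : P →L[ℂ] P} {f : N →L[ℂ] N} (he : IsStarProjection e) (hf : IsStarProjection f) :
    blockDiag i j e f ∈ jSelfadjointProjections J := by
  constructor
  · rw [h.blockDiag_mul, he.isIdempotentElem.eq, hf.isIdempotentElem.eq]
  · rw [h.jAdjoint_blockDiag, he.isSelfAdjoint.star_eq, hf.isSelfAdjoint.star_eq]

/-- Orthogonal projections commuting with `J` are block diagonal. -/
theorem IsSplitting.exists_blockDiag (h : IsSplitting J i j) (hJ : IsSymmetry J) {p : H →L[ℂ] H}
    (hp : IsStarProjection p) (hc : Commute J p) :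
    ∃ (e : P →L[ℂ] P) (f : N →L[ℂ] N), IsStarProjection e ∧ IsStarProjection f ∧
      p = blockDiag i j e f := by
  have hpa : adjoint p = p := hp.isSelfAdjoint.star_eq
  have hiJ : ∀ x, adjoint i (J x) = adjoint i x := by
    intro x
    refine ext_inner_right ℂ fun y => ?_
    rw [adjoint_inner_left, adjoint_inner_left]
    conv_rhs => rw [← h.apply_left y, ← adjoint_inner_left, hJ.1]
  have hcc : ∀ x, J (p x) = p (J x) := fun x => DFunLike.congr_fun hc.eq x
  have hpp : ∀ x, p (p x) = p x := fun x => apply_apply_of_isStarProjection hp x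
  -- Moving `J` across `p` gives `1` on one side and `-1` on the other, so this off-diagonal block
  -- equals its own negative. The other one is its adjoint.
  have h1 : ∀ x, adjoint i (p (j x)) = 0 := by
    intro x
    have h2 : adjoint i (p (j x)) = -adjoint i (p (j x)) := by
      conv_lhs => rw [← hiJ, hcc, h.apply_right, map_neg, map_neg]
    rw [eq_neg_iff_add_eq_zero, ← two_smul ℂ] at h2
    exact (smul_eq_zero.mp h2).resolve_left two_ne_zero
  have h2 : ∀ x, adjoint j (p (i x)) = 0 := by
    have h3 : (adjoint i) ∘L (p ∘L j) = 0 := by ext x; simp [h1]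
    have h4 := congrArg adjoint h3
    rw [adjoint_comp, adjoint_comp, adjoint_adjoint, hpa] at h4
    intro x
    simpa using DFunLike.congr_fun h4 x
  have key : p = blockDiag i j (adjoint i ∘L p ∘L i) (adjoint j ∘L p ∘L j) := by
    ext x
    have e1 : p x = p (i (adjoint i x)) + p (j (adjoint j x)) := by rw [← map_add, h.sum]
    have e2 : p (i (adjoint i x)) = i (adjoint i (p (i (adjoint i x)))) := by
      conv_lhs => rw [← h.sum (p (i (adjoint i x))), h2, map_zero, add_zero]
    have e3 : p (j (adjoint j x)) = j (adjoint j (p (j (adjoint j x)))) := by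
      conv_lhs => rw [← h.sum (p (j (adjoint j x))), h1, map_zero, zero_add]
    rw [e1, e2, e3]
    simp [blockDiag]
  refine ⟨_, _, ⟨?_, ?_⟩, ⟨?_, ?_⟩, key⟩
  · ext x
    change adjoint i (p (i (adjoint i (p (i x))))) = adjoint i (p (i x))
    have e2 : p (i x) = i (adjoint i (p (i x))) := by
      conv_lhs => rw [← h.sum (p (i x)), h2, map_zero, add_zero]
    rw [← e2, hpp]
  · rw [isSelfAdjoint_iff, star_eq_adjoint, adjoint_comp, adjoint_comp, adjoint_adjoint, hpa,
      comp_assoc]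
  · ext x
    change adjoint j (p (j (adjoint j (p (j x))))) = adjoint j (p (j x))
    have e3 : p (j x) = j (adjoint j (p (j x))) := by
      conv_lhs => rw [← h.sum (p (j x)), h1, map_zero, zero_add]
    rw [← e3, hpp]
  · rw [isSelfAdjoint_iff, star_eq_adjoint, adjoint_comp, adjoint_comp, adjoint_adjoint, hpa,
      comp_assoc]

/-- Blockwise path conjugate projections are `J`-unitarily equivalent and joined by a path. -/
theorem IsSplitting.joinedIn_blockDiag (h : IsSplitting J i j) {e e' : P →L[ℂ] P}
    {f f' : N →L[ℂ] N} (he : IsStarProjection e) (hf : IsStarProjection f)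
    (hee : PathConj e e') (hff : PathConj f f') :
    (∃ U ∈ jUnitaries J, U * blockDiag i j e f * jAdjoint J U = blockDiag i j e' f') ∧
      JoinedIn (jSelfadjointProjections J) (blockDiag i j e f) (blockDiag i j e' f') := by
  obtain ⟨V, hV, rfl⟩ := hee
  obtain ⟨W, hW, rfl⟩ := hff
  refine ⟨⟨_, h.blockDiag_mem_jUnitaries V W, by
    rw [h.jAdjoint_blockDiag, h.blockDiag_mul, h.blockDiag_mul]⟩, ?_⟩
  -- The path is the image under `F` of a path of pairs of unitaries from `(1, 1)` to `(V, W)`.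
  let F : unitary (P →L[ℂ] P) × unitary (N →L[ℂ] N) → (H →L[ℂ] H) := fun x =>
    blockDiag i j ((x.1 : P →L[ℂ] P) * e * star (x.1 : P →L[ℂ] P))
      ((x.2 : N →L[ℂ] N) * f * star (x.2 : N →L[ℂ] N))
  have hF : Continuous F := by
    unfold F blockDiag
    fun_prop
  have h1 : JoinedIn (Set.univ) ((1 : unitary (P →L[ℂ] P)), (1 : unitary (N →L[ℂ] N))) (V, W) :=
    joinedIn_univ.mpr (hV.prod hW)
  have h2 := h1.map hF
  have h3 : F (1, 1) = blockDiag i j e f := by simp [F]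
  rw [h3] at h2
  refine h2.mono ?_
  rintro _ ⟨⟨v, w⟩, -, rfl⟩
  refine h.blockDiag_mem_jSelfadjointProjections ?_ ?_
  · exact he.unitary_conj v
  · exact hf.unitary_conj w

end Splitting

/-! ### The indefinite form and local constancy of dimensions -/

section Form

variable {H P : Type u} [NormedAddCommGroup H] [InnerProductSpace ℂ H]
  [NormedAddCommGroup P] [InnerProductSpace ℂ P] {J : H →L[ℂ] H}

theorem mem_range_iff_of_idempotent {E : H →L[ℂ] H} (hE : E * E = E) (x : H) :
    x ∈ LinearMap.range (E : H →ₗ[ℂ] H) ↔ E x = x := by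
  refine ⟨?_, fun h => ⟨x, h⟩⟩
  rintro ⟨y, rfl⟩
  exact DFunLike.congr_fun hE y

theorem uniformlyJPositive_map {T : P →L[ℂ] H} (h : ∀ x, (kreinInner J (T x) (T x)).re = ‖x‖ ^ 2)
    (S : Submodule ℂ P) : UniformlyJPositive J (S.map (T : P →ₗ[ℂ] H)) := by
  -- The bound is `‖T x‖ ≤ (‖T‖ + 1) ‖x‖`; the added `1` covers `T = 0`.
  refine ⟨((‖T‖ + 1) ^ 2)⁻¹, by positivity, ?_⟩
  rintro _ ⟨x, -, rfl⟩
  change _ * ‖T x‖ ^ 2 ≤ (kreinInner J (T x) (T x)).re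
  rw [h, inv_mul_le_iff₀ (by positivity), ← mul_pow]
  refine pow_le_pow_left₀ (norm_nonneg _) ((T.le_opNorm x).trans ?_) 2
  exact mul_le_mul_of_nonneg_right (by linarith) (norm_nonneg x)

/-- Passing from `J` to `-J` exchanges the two signs, so statements about positive parts also serve
for negative ones. -/
theorem uniformlyJNegative_iff (S : Submodule ℂ H) :
    UniformlyJNegative J S ↔ UniformlyJPositive (-J) S := by
  unfold UniformlyJNegative UniformlyJPositive kreinInner
  refine exists_congr fun c => and_congr_right fun _ => forall₂_congr fun f _ => ?_
  rw [neg_apply, inner_neg_right, Complex.neg_re]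
  exact le_neg

theorem uniformlyJPositive_iff (S : Submodule ℂ H) :
    UniformlyJPositive J S ↔ UniformlyJNegative (-J) S := by
  rw [uniformlyJNegative_iff, neg_neg]

theorem dim_map_of_injective {T : P →L[ℂ] H} (hT : Function.Injective T) (S : Submodule ℂ P) :
    dim (S.map (T : P →ₗ[ℂ] H)) = dim S := by
  unfold dim
  rw [(Submodule.equivMapOfInjective (T : P →ₗ[ℂ] H) hT S).rank_eq]

/-- `T` is injective on `S` and its image meets `L` only in `0`, so `S` embeds in `(M ⊔ L) / L`, a
quotient of `M`. -/
theorem dim_le_of_map {T : H →L[ℂ] H} {S M L : Submodule ℂ H}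
    (hmap : ∀ x ∈ S, T x ∈ M ⊔ L) (hker : ∀ x ∈ S, T x ∈ L → x = 0) : dim S ≤ dim M := by
  have hinj : Function.Injective ((T : H →ₗ[ℂ] H).domRestrict S) := by
    rw [← LinearMap.ker_eq_bot, LinearMap.ker_eq_bot']
    intro x hx
    have hx' : T x = 0 := hx
    exact Subtype.ext (hker x x.2 (hx' ▸ L.zero_mem))
  have h1 : dim S = dim (S.map (T : H →ₗ[ℂ] H)) := by
    unfold dim
    rw [(LinearEquiv.ofInjective _ hinj).rank_eq, LinearMap.range_domRestrict]
  rw [h1]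
  refine dim_le_of_disjoint (N := L) ?_ ?_
  · rw [Submodule.disjoint_def]
    rintro _ ⟨x, hx, rfl⟩ hL
    rw [hker x hx hL, map_zero]
  · rintro _ ⟨x, hx, rfl⟩
    rw [sup_comm]
    exact hmap x hx

theorem abs_kreinInner_sub_le (f g : H) :
    |(kreinInner J g g).re - (kreinInner J f f).re| ≤ ‖J‖ * ‖g - f‖ * (‖g‖ + ‖f‖) := by
  have h1 : kreinInner J g g - kreinInner J f f = ⟪g - f, J g⟫_ℂ + ⟪f, J (g - f)⟫_ℂ := by
    simp only [kreinInner, map_sub, inner_sub_left, inner_sub_right]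
    ring
  rw [← Complex.sub_re, h1]
  refine (Complex.abs_re_le_norm _).trans ((norm_add_le _ _).trans ?_)
  have h2 : ‖⟪g - f, J g⟫_ℂ‖ ≤ ‖g - f‖ * (‖J‖ * ‖g‖) :=
    (norm_inner_le_norm _ _).trans (by gcongr; exact J.le_opNorm g)
  have h3 : ‖⟪f, J (g - f)⟫_ℂ‖ ≤ ‖f‖ * (‖J‖ * ‖g - f‖) :=
    (norm_inner_le_norm _ _).trans (by gcongr; exact J.le_opNorm _)
  linarith

/-- The dimension of the positive part of the range of a projection is locally constant. -/
theorem exists_dim_eq_of_norm_sub_lt {E₀ : H →L[ℂ] H} (hE₀ : E₀ * E₀ = E₀)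
    {P₀ N₀ : Submodule ℂ H} (hP₀ : UniformlyJPositive J P₀) (hN₀ : UniformlyJNegative J N₀)
    (hsup₀ : P₀ ⊔ N₀ = LinearMap.range (E₀ : H →ₗ[ℂ] H)) :
    ∃ ε > 0, ∀ E : H →L[ℂ] H, E * E = E → ‖E - E₀‖ < ε → ∀ P N : Submodule ℂ H,
      UniformlyJPositive J P → UniformlyJNegative J N →
      P ⊔ N = LinearMap.range (E : H →ₗ[ℂ] H) → dim P = dim P₀ := by
  obtain ⟨c, hc, hP₀⟩ := hP₀
  obtain ⟨d, hd, hN₀⟩ := hN₀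
  -- Only `c` and `d`, which belong to `E₀`, may enter; the constants of `P` and `N` vary with `E`.
  -- The bound `1/2` keeps the norms of `f` and its image within a factor `2`. The form then changes
  -- by at most `3‖J‖δ‖f‖² ≤ 12‖J‖δ‖g‖²`, which the second bound keeps below `c‖g‖²` and `d‖g‖²`.
  refine ⟨min (1 / 2) (min c d / (12 * (‖J‖ + 1))), by positivity, ?_⟩
  rintro E hE hlt P N ⟨a, ha, hP⟩ ⟨b, hb, hN⟩ hsup
  set δ := ‖E - E₀‖ with hδ
  have hδ0 : 0 ≤ δ := norm_nonneg _
  have hδ1 : δ < 1 / 2 := hlt.trans_le (min_le_left _ _)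
  have hδ2 : 12 * (‖J‖ * δ) < min c d := by
    have h1 := hlt.trans_le (min_le_right _ _)
    rw [lt_div_iff₀ (by positivity)] at h1
    linarith
  have hδc : 12 * (‖J‖ * δ) < c := hδ2.trans_le (min_le_left _ _)
  have hδd : 12 * (‖J‖ * δ) < d := hδ2.trans_le (min_le_right _ _)
  -- the form changes little between `f` and a nearby vector `g`
  have key : ∀ f g : H, ‖g - f‖ ≤ δ * ‖f‖ →
      |(kreinInner J g g).re - (kreinInner J f f).re| ≤ 3 * (‖J‖ * δ) * ‖f‖ ^ 2 ∧
      ‖f‖ ^ 2 ≤ 4 * ‖g‖ ^ 2 := by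
    intro f g h
    have hf := norm_nonneg f
    have h1 : ‖g‖ ≤ 2 * ‖f‖ := by
      have := norm_le_norm_add_norm_sub' g f
      nlinarith
    have h2 : ‖f‖ ≤ 2 * ‖g‖ := by
      have := norm_le_norm_add_norm_sub' f g
      rw [norm_sub_rev] at this
      nlinarith
    constructor
    · refine (abs_kreinInner_sub_le f g).trans ?_
      calc ‖J‖ * ‖g - f‖ * (‖g‖ + ‖f‖) ≤ ‖J‖ * (δ * ‖f‖) * (2 * ‖f‖ + ‖f‖) := by gcongr
        _ = _ := by ring
    · nlinarith
  have hz : ∀ f : H, ‖f‖ ^ 2 ≤ 0 → f = 0 := fun f h => by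
    have := pow_eq_zero_iff (two_ne_zero) |>.mp (le_antisymm h (sq_nonneg ‖f‖))
    exact norm_eq_zero.mp this
  refine le_antisymm ?_ ?_
  -- A nonzero `f ∈ P` with `E₀ f ∈ N₀` would have form at least `0` at `f` and at most `-d‖E₀ f‖²`
  -- at the nearby `E₀ f`, too large a drop.
  · refine dim_le_of_map (T := E₀) (L := N₀) (fun x _ => hsup₀ ▸ ⟨x, rfl⟩) fun f hf hfN => ?_
    have hEf : E f = f :=
      (mem_range_iff_of_idempotent hE f).mp (hsup ▸ Submodule.mem_sup_left hf)
    have h1 : ‖E₀ f - f‖ ≤ δ * ‖f‖ := by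
      calc ‖E₀ f - f‖ = ‖(E - E₀) f‖ := by rw [sub_apply, hEf, norm_sub_rev]
        _ ≤ _ := le_opNorm _ _
    obtain ⟨h2, h3⟩ := key f (E₀ f) h1
    have h4 := hN₀ _ hfN
    have h5 := hP f hf
    have h6 : 0 ≤ a * ‖f‖ ^ 2 := by positivity
    have h7 := (abs_le.mp h2).1
    refine hz f ?_
    by_contra h8
    push Not at h8
    nlinarith
  -- Symmetrically, the form is at least `c‖f‖²` at `f ∈ P₀` and at most `0` at `E f ∈ N`.
  · refine dim_le_of_map (T := E) (L := N) (fun x _ => hsup ▸ ⟨x, rfl⟩) fun f hf hfN => ?_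
    have hEf : E₀ f = f :=
      (mem_range_iff_of_idempotent hE₀ f).mp (hsup₀ ▸ Submodule.mem_sup_left hf)
    have h1 : ‖E f - f‖ ≤ δ * ‖f‖ := by
      calc ‖E f - f‖ = ‖(E - E₀) f‖ := by rw [sub_apply, hEf]
        _ ≤ _ := le_opNorm _ _
    obtain ⟨h2, h3⟩ := key f (E f) h1
    have h4 := hN _ hfN
    have h5 := hP₀ f hf
    have h6 : 0 ≤ b * ‖E f‖ ^ 2 := by positivity
    have h7 := (abs_le.mp h2).1
    refine hz f ?_
    by_contra h8
    push Not at h8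
    nlinarith

end Form

/-! ### Signatures and cosignatures of ranges -/

section Signature

variable {H P N : Type u} [NormedAddCommGroup H] [InnerProductSpace ℂ H] [CompleteSpace H]
  [NormedAddCommGroup P] [InnerProductSpace ℂ P] [CompleteSpace P]
  [NormedAddCommGroup N] [InnerProductSpace ℂ N] [CompleteSpace N]
  {J : H →L[ℂ] H} {i : P →L[ℂ] H} {j : N →L[ℂ] H}

theorem one_sub_mem_jSelfadjointProjections (hJ : IsSymmetry J) {E : H →L[ℂ] H}
    (hE : E ∈ jSelfadjointProjections J) : 1 - E ∈ jSelfadjointProjections J := by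
  refine ⟨?_, by rw [jAdjoint_one_sub hJ, hE.2]⟩
  have := hE.1
  rw [sub_mul, one_mul, mul_sub, mul_one, this, sub_self, sub_zero]

/-- `R(E)^[⊥] = R(1 - E)` for a `J`-selfadjoint projection `E`. -/
theorem jOrthogonal_range (hJ : IsSymmetry J) {E : H →L[ℂ] H}
    (hE : E ∈ jSelfadjointProjections J) :
    jOrthogonal J (LinearMap.range (E : H →ₗ[ℂ] H)) =
      LinearMap.range ((1 - E : H →L[ℂ] H) : H →ₗ[ℂ] H) := by
  ext f
  rw [mem_range_iff_of_idempotent (one_sub_mem_jSelfadjointProjections hJ hE).1]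
  have h1 : J (adjoint E (J f)) = E f := DFunLike.congr_fun hE.2 f
  have hJJ : ∀ x, J (J x) = x := fun x => DFunLike.congr_fun hJ.2 x
  have h2 : (1 - E) f = f ↔ E f = 0 := by simp
  rw [h2, ← h1]
  constructor
  · intro h
    have : adjoint E (J f) = 0 := by
      refine ext_inner_left ℂ fun y => ?_
      rw [adjoint_inner_right, inner_zero_right]
      exact h (E y) ⟨y, rfl⟩
    rw [this, map_zero]
  · rintro h _ ⟨y, rfl⟩
    change ⟪E y, J f⟫_ℂ = 0
    rw [← adjoint_inner_right, ← hJJ (adjoint E (J f)), h, map_zero, inner_zero_right]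

theorem isCompl_range_one_sub (hJ : IsSymmetry J) {E : H →L[ℂ] H}
    (hE : E ∈ jSelfadjointProjections J) : IsCompl (LinearMap.range (E : H →ₗ[ℂ] H))
      (LinearMap.range ((1 - E : H →L[ℂ] H) : H →ₗ[ℂ] H)) := by
  constructor
  · rw [Submodule.disjoint_def]
    intro x h1 h2
    rw [mem_range_iff_of_idempotent hE.1] at h1
    rw [mem_range_iff_of_idempotent (one_sub_mem_jSelfadjointProjections hJ hE).1] at h2
    simpa [h1] using h2.symm
  · rw [codisjoint_iff, eq_top_iff]
    intro x _
    have : x = E x + (1 - E) x := by simp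
    rw [this]
    exact Submodule.add_mem_sup ⟨x, rfl⟩ ⟨x, rfl⟩

theorem isotropicPart_range (hJ : IsSymmetry J) {E : H →L[ℂ] H}
    (hE : E ∈ jSelfadjointProjections J) :
    isotropicPart J (LinearMap.range (E : H →ₗ[ℂ] H)) = ⊥ := by
  rw [isotropicPart, jOrthogonal_range hJ hE]
  exact (isCompl_range_one_sub hJ hE).inf_eq_bot

/-- The range of `E` is regular with complement the range of `1 - E`, so the isotropic part vanishes
and the regularity clause is automatic. -/
theorem isSignatureDecomposition_of_sup_eq_range (hJ : IsSymmetry J) {E : H →L[ℂ] H}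
    (hE : E ∈ jSelfadjointProjections J) {Mp Mm : Submodule ℂ H} (hp : UniformlyJPositive J Mp)
    (hm : UniformlyJNegative J Mm) (ho : ∀ f ∈ Mp, ∀ g ∈ Mm, kreinInner J f g = 0)
    (hsup : Mp ⊔ Mm = LinearMap.range (E : H →ₗ[ℂ] H)) :
    IsSignatureDecomposition J (LinearMap.range (E : H →ₗ[ℂ] H)) Mp Mm := by
  have hcompl := isCompl_range_one_sub hJ hE
  have hiso := isotropicPart_range hJ hE
  refine ⟨hp, hm, ho, ?_, ?_, ?_, ?_⟩
  · have h1 : Mm ≤ LinearMap.range (E : H →ₗ[ℂ] H) := hsup ▸ le_sup_right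
    have h2 : Mp ≤ LinearMap.range (E : H →ₗ[ℂ] H) := hsup ▸ le_sup_left
    exact (isotropic_sup_disjoint hJ h1 hp hm h2).1.mono_right le_sup_right
  · rw [hsup, IsJRegular, jOrthogonal_range hJ hE]
    exact hcompl
  · rw [hiso]; exact disjoint_bot_left
  · rw [hiso, bot_sup_eq, hsup]

theorem kreinInner_apply_of_mem_jUnitaries (hJ : IsSymmetry J) {U : H →L[ℂ] H}
    (hU : U ∈ jUnitaries J) (f g : H) : kreinInner J (U f) (U g) = kreinInner J f g := by
  have h1 : adjoint U * J * U = J := by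
    calc adjoint U * J * U = (J * J) * adjoint U * J * U := by rw [hJ.2, one_mul]
      _ = J * (jAdjoint J U * U) := by unfold jAdjoint; noncomm_ring
      _ = J := by rw [hU.2, mul_one]
  unfold kreinInner
  rw [← adjoint_inner_right]
  exact congrArg _ (DFunLike.congr_fun h1 f)

/-- The range of a projection conjugate to a block diagonal one has a signature decomposition
into the images of the ranges of the blocks. -/
theorem IsSplitting.isSignatureDecomposition (h : IsSplitting J i j) (hJ : IsSymmetry J)
    {U : H →L[ℂ] H} (hU : U ∈ jUnitaries J) {e : P →L[ℂ] P} {f : N →L[ℂ] N}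
    (he : IsStarProjection e) (hf : IsStarProjection f) :
    IsSignatureDecomposition J
      (LinearMap.range ((U * blockDiag i j e f * jAdjoint J U : H →L[ℂ] H) : H →ₗ[ℂ] H))
      ((LinearMap.range (e : P →ₗ[ℂ] P)).map ((U ∘L i : P →L[ℂ] H) : P →ₗ[ℂ] H))
      ((LinearMap.range (f : N →ₗ[ℂ] N)).map ((U ∘L j : N →L[ℂ] H) : N →ₗ[ℂ] H)) := by
  have hee : ∀ x, e (e x) = e x := apply_apply_of_isStarProjection he
  have hff : ∀ x, f (f x) = f x := apply_apply_of_isStarProjection hf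
  have hUU : ∀ x, jAdjoint J U (U x) = x := fun x => DFunLike.congr_fun hU.2 x
  have hUU' : ∀ x, U (jAdjoint J U x) = x := fun x => DFunLike.congr_fun hU.1 x
  refine isSignatureDecomposition_of_sup_eq_range hJ (conj_mem_jSelfadjointProjections hJ hU
    (h.blockDiag_mem_jSelfadjointProjections he hf)) ?_ ?_ ?_ ?_
  · refine uniformlyJPositive_map (fun x => ?_) _
    rw [comp_apply, kreinInner_apply_of_mem_jUnitaries hJ hU, kreinInner, h.apply_left,
      ← adjoint_inner_right, h.left, inner_self_eq_norm_sq_to_K]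
    norm_cast
  · rw [uniformlyJNegative_iff]
    refine uniformlyJPositive_map (fun x => ?_) _
    have h1 : kreinInner (-J) (U (j x)) (U (j x)) = - kreinInner J (U (j x)) (U (j x)) := by
      simp [kreinInner]
    rw [comp_apply, h1, kreinInner_apply_of_mem_jUnitaries hJ hU, kreinInner, h.apply_right,
      inner_neg_right, neg_neg, ← adjoint_inner_right, h.right, inner_self_eq_norm_sq_to_K]
    norm_cast
  · rintro _ ⟨x, -, rfl⟩ _ ⟨y, -, rfl⟩
    change kreinInner J (U (i x)) (U (j y)) = 0
    rw [kreinInner_apply_of_mem_jUnitaries hJ hU, kreinInner, h.apply_left, ← adjoint_inner_right,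
      h.right_left, inner_zero_right]
  · refine le_antisymm (sup_le ?_ ?_) ?_
    · rintro _ ⟨_, ⟨x, rfl⟩, rfl⟩
      exact ⟨U (i (e x)), by simp [blockDiag, hUU, h.left, h.right_left, hee]⟩
    · rintro _ ⟨_, ⟨x, rfl⟩, rfl⟩
      exact ⟨U (j (f x)), by simp [blockDiag, hUU, h.right, h.left_right, hff]⟩
    · rintro _ ⟨x, rfl⟩
      have : (U * blockDiag i j e f * jAdjoint J U) x =
          U (i (e (adjoint i (jAdjoint J U x)))) + U (j (f (adjoint j (jAdjoint J U x)))) := by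
        simp [blockDiag]
      change (U * blockDiag i j e f * jAdjoint J U) x ∈ _
      rw [this]
      exact Submodule.add_mem_sup ⟨_, ⟨_, rfl⟩, rfl⟩ ⟨_, ⟨_, rfl⟩, rfl⟩

theorem IsSplitting.signature_eq (h : IsSplitting J i j) (hJ : IsSymmetry J)
    {U : H →L[ℂ] H} (hU : U ∈ jUnitaries J) {e : P →L[ℂ] P} {f : N →L[ℂ] N}
    (he : IsStarProjection e) (hf : IsStarProjection f) :
    posSignature J (LinearMap.range
        ((U * blockDiag i j e f * jAdjoint J U : H →L[ℂ] H) : H →ₗ[ℂ] H)) =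
      dim (LinearMap.range (e : P →ₗ[ℂ] P)) ∧
    negSignature J (LinearMap.range
        ((U * blockDiag i j e f * jAdjoint J U : H →L[ℂ] H) : H →ₗ[ℂ] H)) =
      dim (LinearMap.range (f : N →ₗ[ℂ] N)) := by
  have h1 := h.isSignatureDecomposition hJ hU he hf
  have hUU : Function.Injective U :=
    Function.LeftInverse.injective (g := jAdjoint J U) fun x => DFunLike.congr_fun hU.2 x
  refine ⟨?_, ?_⟩
  · rw [posSignature_eq hJ h1, dim_map_of_injective]
    exact hUU.comp (Function.LeftInverse.injective h.left)
  · rw [negSignature_eq hJ h1, dim_map_of_injective]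
    exact hUU.comp (Function.LeftInverse.injective h.right)

/-- Complementing commutes with conjugation and with forming blocks, so this is
`IsSplitting.signature_eq` for `1 - e` and `1 - f`. -/
theorem IsSplitting.cosignature_eq (h : IsSplitting J i j) (hJ : IsSymmetry J)
    {U : H →L[ℂ] H} (hU : U ∈ jUnitaries J) {e : P →L[ℂ] P} {f : N →L[ℂ] N}
    (he : IsStarProjection e) (hf : IsStarProjection f) :
    posCosignature J (LinearMap.range
        ((U * blockDiag i j e f * jAdjoint J U : H →L[ℂ] H) : H →ₗ[ℂ] H)) =
      dim (LinearMap.range ((1 - e : P →L[ℂ] P) : P →ₗ[ℂ] P)) ∧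
    negCosignature J (LinearMap.range
        ((U * blockDiag i j e f * jAdjoint J U : H →L[ℂ] H) : H →ₗ[ℂ] H)) =
      dim (LinearMap.range ((1 - f : N →L[ℂ] N) : N →ₗ[ℂ] N)) := by
  unfold posCosignature negCosignature
  rw [jOrthogonal_range hJ (conj_mem_jSelfadjointProjections hJ hU
    (h.blockDiag_mem_jSelfadjointProjections he hf))]
  have h1 : 1 - U * blockDiag i j e f * jAdjoint J U =
      U * blockDiag i j (1 - e) (1 - f) * jAdjoint J U := by
    rw [blockDiag_sub, h.blockDiag_one, mul_sub, sub_mul, mul_one, hU.1]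
  rw [h1]
  exact h.signature_eq hJ hU he.one_sub hf.one_sub

end Signature

/-! ### Orbits, components and signature classes -/

section Orbit

variable {H : Type u} [NormedAddCommGroup H] [InnerProductSpace ℂ H] [CompleteSpace H]
  {J : H →L[ℂ] H}

/-- The inclusions of the eigenspaces of a symmetry split the space. -/
theorem isSplitting_subtypeL (hJ : IsSymmetry J) {P N : Submodule ℂ H} [CompleteSpace P]
    [CompleteSpace N] (hP : ∀ x, x ∈ P ↔ J x = x) (hN : ∀ x, x ∈ N ↔ J x = -x) :
    IsSplitting J P.subtypeL N.subtypeL := by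
  have hJJ : ∀ x, J (J x) = x := fun x => DFunLike.congr_fun hJ.2 x
  have hPN : ∀ (x : P) (y : N), ⟪(x : H), (y : H)⟫_ℂ = 0 := by
    intro x y
    have h1 : ⟪(x : H), (y : H)⟫_ℂ = -⟪(x : H), (y : H)⟫_ℂ := by
      conv_lhs => rw [← (hP x).mp x.2, ← adjoint_inner_right, hJ.1, (hN y).mp y.2, inner_neg_right]
    exact self_eq_neg.mp h1
  have h1 : ∀ x, adjoint P.subtypeL (P.subtypeL x) = x := fun x =>
    ext_inner_right ℂ fun y => by rw [adjoint_inner_left]; rfl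
  have h2 : ∀ x, adjoint N.subtypeL (N.subtypeL x) = x := fun x =>
    ext_inner_right ℂ fun y => by rw [adjoint_inner_left]; rfl
  have h3 : ∀ x, adjoint P.subtypeL (N.subtypeL x) = 0 := fun x =>
    ext_inner_left ℂ fun y => by
      rw [adjoint_inner_right, inner_zero_right]; exact hPN y x
  have h4 : ∀ x, adjoint N.subtypeL (P.subtypeL x) = 0 := fun x =>
    ext_inner_right ℂ fun y => by
      rw [adjoint_inner_left, inner_zero_left]; exact hPN x y
  refine ⟨h1, h2, h3, h4, fun x => ?_, fun x => (hP _).mp x.2, fun x => (hN _).mp x.2⟩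
  have ha : (2⁻¹ : ℂ) • (x + J x) ∈ P := by
    rw [hP, map_smul, map_add, hJJ, add_comm]
  have hb : (2⁻¹ : ℂ) • (x - J x) ∈ N := by
    rw [hN, map_smul, map_sub, hJJ, ← smul_neg, neg_sub]
  have hx : x = P.subtypeL ⟨_, ha⟩ + N.subtypeL ⟨_, hb⟩ := by
    change x = (2⁻¹ : ℂ) • (x + J x) + (2⁻¹ : ℂ) • (x - J x)
    module
  conv_lhs => rw [hx]
  simp only [map_add, h1, h2, h3, h4, add_zero, zero_add]
  exact hx.symm

variable {P N : Type u} [NormedAddCommGroup P] [InnerProductSpace ℂ P] [CompleteSpace P]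
  [NormedAddCommGroup N] [InnerProductSpace ℂ N] [CompleteSpace N]
  {i : P →L[ℂ] H} {j : N →L[ℂ] H}

theorem IsSplitting.exists_model (h : IsSplitting J i j) (hJ : IsSymmetry J) {E : H →L[ℂ] H}
    (hE : E ∈ jSelfadjointProjections J) :
    ∃ U ∈ jUnitaries J, ∃ (e : P →L[ℂ] P) (f : N →L[ℂ] N), IsStarProjection e ∧
      IsStarProjection f ∧ E = U * blockDiag i j e f * jAdjoint J U ∧
      JoinedIn (jSelfadjointProjections J) E (blockDiag i j e f) := by
  obtain ⟨U, hU, p, hp, hc, hEU, hjoin⟩ := exists_orthogonal_model hJ hE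
  obtain ⟨e, f, he, hf, rfl⟩ := h.exists_blockDiag hJ hp hc
  exact ⟨U, hU, e, f, he, hf, hEU, hjoin⟩

theorem IsSplitting.exists_signatureDecomposition (h : IsSplitting J i j) (hJ : IsSymmetry J)
    {E : H →L[ℂ] H} (hE : E ∈ jSelfadjointProjections J) :
    ∃ Mp Mm, IsSignatureDecomposition J (LinearMap.range (E : H →ₗ[ℂ] H)) Mp Mm ∧
      Mp ⊔ Mm = LinearMap.range (E : H →ₗ[ℂ] H) := by
  have hiso := isotropicPart_range hJ hE
  obtain ⟨U, hU, e, f, he, hf, rfl, -⟩ := h.exists_model hJ hE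
  have hd := h.isSignatureDecomposition hJ hU he hf
  have hsup := hd.sup_eq
  rw [hiso, bot_sup_eq] at hsup
  exact ⟨_, _, hd, hsup⟩

/-- Both signatures of the range are locally constant on the `J`-selfadjoint projections. -/
theorem IsSplitting.eventually_signature_eq (h : IsSplitting J i j) (hJ : IsSymmetry J)
    {E₀ : H →L[ℂ] H} (hE₀ : E₀ ∈ jSelfadjointProjections J) :
    ∃ ε > 0, ∀ E ∈ jSelfadjointProjections J, ‖E - E₀‖ < ε →
      posSignature J (LinearMap.range (E : H →ₗ[ℂ] H)) =
          posSignature J (LinearMap.range (E₀ : H →ₗ[ℂ] H)) ∧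
        negSignature J (LinearMap.range (E : H →ₗ[ℂ] H)) =
          negSignature J (LinearMap.range (E₀ : H →ₗ[ℂ] H)) := by
  obtain ⟨P₀, N₀, h₀, hs₀⟩ := h.exists_signatureDecomposition hJ hE₀
  obtain ⟨ε, hε, hpos⟩ := exists_dim_eq_of_norm_sub_lt hE₀.1 h₀.uniformlyPositive
    h₀.uniformlyNegative hs₀
  obtain ⟨η, hη, hneg⟩ := exists_dim_eq_of_norm_sub_lt hE₀.1
    ((uniformlyJNegative_iff _).mp h₀.uniformlyNegative)
    ((uniformlyJPositive_iff _).mp h₀.uniformlyPositive) (by rw [sup_comm, hs₀])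
  refine ⟨min ε η, lt_min hε hη, fun E hE hlt => ?_⟩
  obtain ⟨P₁, N₁, h₁, hs₁⟩ := h.exists_signatureDecomposition hJ hE
  rw [posSignature_eq hJ h₁, posSignature_eq hJ h₀, negSignature_eq hJ h₁, negSignature_eq hJ h₀]
  exact ⟨hpos E hE.1 (hlt.trans_le (min_le_left _ _)) _ _ h₁.uniformlyPositive
      h₁.uniformlyNegative hs₁,
    hneg E hE.1 (hlt.trans_le (min_le_right _ _)) _ _
      ((uniformlyJNegative_iff _).mp h₁.uniformlyNegative)
      ((uniformlyJPositive_iff _).mp h₁.uniformlyPositive) (by rw [sup_comm, hs₁])⟩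

/-- The signatures and cosignatures of the ranges of `E` and `E₀` agree. -/
def SameSignatures (J E E₀ : H →L[ℂ] H) : Prop :=
  posSignature J (LinearMap.range (E : H →ₗ[ℂ] H)) =
      posSignature J (LinearMap.range (E₀ : H →ₗ[ℂ] H)) ∧
    negSignature J (LinearMap.range (E : H →ₗ[ℂ] H)) =
      negSignature J (LinearMap.range (E₀ : H →ₗ[ℂ] H)) ∧
    posCosignature J (LinearMap.range (E : H →ₗ[ℂ] H)) =
      posCosignature J (LinearMap.range (E₀ : H →ₗ[ℂ] H)) ∧
    negCosignature J (LinearMap.range (E : H →ₗ[ℂ] H)) =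
      negCosignature J (LinearMap.range (E₀ : H →ₗ[ℂ] H))

/-- An equivalence relation that holds near each point of a preconnected set holds throughout it.
The cosignatures follow by applying local constancy to `1 - E`, since `E ↦ 1 - E` is isometric. -/
theorem IsSplitting.sameSignatures_of_mem_connectedComponentIn (h : IsSplitting J i j)
    (hJ : IsSymmetry J) {E E₀ : H →L[ℂ] H} (hE₀ : E₀ ∈ jSelfadjointProjections J)
    (hE : E ∈ connectedComponentIn (jSelfadjointProjections J) E₀) : SameSignatures J E E₀ := by
  refine isPreconnected_connectedComponentIn.induction₂ (SameSignatures J) ?_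
    (fun x y z _ _ _ h1 h2 => ⟨h1.1.trans h2.1, h1.2.1.trans h2.2.1, h1.2.2.1.trans h2.2.2.1,
      h1.2.2.2.trans h2.2.2.2⟩)
    (fun x y _ _ h1 => ⟨h1.1.symm, h1.2.1.symm, h1.2.2.1.symm, h1.2.2.2.symm⟩) hE
    (mem_connectedComponentIn hE₀)
  intro F hF
  have hF' := connectedComponentIn_subset _ _ hF
  obtain ⟨ε, hε, h1⟩ := h.eventually_signature_eq hJ hF'
  obtain ⟨η, hη, h2⟩ := h.eventually_signature_eq hJ (one_sub_mem_jSelfadjointProjections hJ hF')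
  filter_upwards [self_mem_nhdsWithin,
    mem_nhdsWithin_of_mem_nhds (Metric.ball_mem_nhds F (lt_min hε hη))] with G hG hGF
  have hG' := connectedComponentIn_subset _ _ hG
  rw [Metric.mem_ball, dist_eq_norm] at hGF
  have h3 := h1 G hG' (hGF.trans_le (min_le_left _ _))
  have h4 := h2 (1 - G) (one_sub_mem_jSelfadjointProjections hJ hG') (by
    rw [sub_sub_sub_cancel_left, norm_sub_rev]
    exact hGF.trans_le (min_le_right _ _))
  rw [← jOrthogonal_range hJ hF', ← jOrthogonal_range hJ hG'] at h4
  exact ⟨h3.1.symm, h3.2.symm, h4.1.symm, h4.2.symm⟩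

/-- `E` and `E₀` are conjugates of one block-diagonal model, and the formulas for the four numbers
do not involve the conjugating `J`-unitary. -/
theorem IsSplitting.sameSignatures_of_mem_jOrbit (h : IsSplitting J i j) (hJ : IsSymmetry J)
    {E E₀ : H →L[ℂ] H} (hE₀ : E₀ ∈ jSelfadjointProjections J) (hE : E ∈ jOrbit J E₀) :
    SameSignatures J E E₀ := by
  obtain ⟨V, hV, rfl⟩ := hE
  obtain ⟨U, hU, e, f, he, hf, rfl, -⟩ := h.exists_model hJ hE₀
  have hVU := mul_mem_jUnitaries hJ hV hU
  have h1 : V * (U * blockDiag i j e f * jAdjoint J U) * jAdjoint J V =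
      V * U * blockDiag i j e f * jAdjoint J (V * U) := by
    rw [jAdjoint_mul hJ]; noncomm_ring
  rw [h1]
  have a := h.signature_eq hJ hVU he hf
  have a' := h.signature_eq hJ hU he hf
  have b := h.cosignature_eq hJ hVU he hf
  have b' := h.cosignature_eq hJ hU he hf
  exact ⟨a.1.trans a'.1.symm, a.2.trans a'.2.symm, b.1.trans b'.1.symm, b.2.trans b'.2.symm⟩

theorem IsSplitting.mem_jOrbit_and_joinedIn_of_sameSignatures
    [TopologicalSpace.SeparableSpace P] [TopologicalSpace.SeparableSpace N]
    (h : IsSplitting J i j) (hJ : IsSymmetry J)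
    {E E₀ : H →L[ℂ] H} (hE : E ∈ jSelfadjointProjections J)
    (hE₀ : E₀ ∈ jSelfadjointProjections J) (hs : SameSignatures J E E₀) :
    E ∈ jOrbit J E₀ ∧ JoinedIn (jSelfadjointProjections J) E₀ E := by
  obtain ⟨U, hU, e, f, he, hf, rfl, hjoin⟩ := h.exists_model hJ hE
  obtain ⟨U₀, hU₀, e₀, f₀, he₀, hf₀, rfl, hjoin₀⟩ := h.exists_model hJ hE₀
  obtain ⟨h1, h2, h3, h4⟩ := hs
  rw [(h.signature_eq hJ hU he hf).1, (h.signature_eq hJ hU₀ he₀ hf₀).1] at h1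
  rw [(h.signature_eq hJ hU he hf).2, (h.signature_eq hJ hU₀ he₀ hf₀).2] at h2
  rw [(h.cosignature_eq hJ hU he hf).1, (h.cosignature_eq hJ hU₀ he₀ hf₀).1] at h3
  rw [(h.cosignature_eq hJ hU he hf).2, (h.cosignature_eq hJ hU₀ he₀ hf₀).2] at h4
  -- The four equalities are now equal ranks and coranks of the blocks. Conjugation and path both go
  -- from `E₀` to its model, across to the model of `E`, and back to `E`.
  obtain ⟨⟨V, hV, hVe⟩, hj⟩ := h.joinedIn_blockDiag he₀ hf₀
    (pathConj_of_dim_eq he₀ he h1.symm h3.symm) (pathConj_of_dim_eq hf₀ hf h2.symm h4.symm)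
  refine ⟨⟨U * V * jAdjoint J U₀, mul_mem_jUnitaries hJ (mul_mem_jUnitaries hJ hU hV)
    (jAdjoint_mem_jUnitaries hJ hU₀), ?_⟩, (hjoin₀.trans hj).trans hjoin.symm⟩
  rw [← hVe, jAdjoint_mul hJ, jAdjoint_mul hJ, jAdjoint_jAdjoint hJ]
  calc U * (V * blockDiag i j e₀ f₀ * jAdjoint J V) * jAdjoint J U
      = U * V * 1 * blockDiag i j e₀ f₀ * 1 * jAdjoint J V * jAdjoint J U := by noncomm_ring
    _ = _ := by rw [← hU₀.2]; noncomm_ring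

end Orbit

end Krein

theorem mainTheorem10 {H : Type*} [NormedAddCommGroup H] [InnerProductSpace ℂ H]
    [CompleteSpace H] [TopologicalSpace.SeparableSpace H]
    (J : H →L[ℂ] H) (hJ : Krein.IsSymmetry J) (E E₀ : H →L[ℂ] H)
    (hE : E ∈ Krein.jSelfadjointProjections J) (hE₀ : E₀ ∈ Krein.jSelfadjointProjections J) :
    (E ∈ Krein.jOrbit J E₀ ↔
      Krein.posSignature J (LinearMap.range (E : H →ₗ[ℂ] H)) =
          Krein.posSignature J (LinearMap.range (E₀ : H →ₗ[ℂ] H)) ∧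
        Krein.negSignature J (LinearMap.range (E : H →ₗ[ℂ] H)) =
          Krein.negSignature J (LinearMap.range (E₀ : H →ₗ[ℂ] H)) ∧
        Krein.posCosignature J (LinearMap.range (E : H →ₗ[ℂ] H)) =
          Krein.posCosignature J (LinearMap.range (E₀ : H →ₗ[ℂ] H)) ∧
        Krein.negCosignature J (LinearMap.range (E : H →ₗ[ℂ] H)) =
          Krein.negCosignature J (LinearMap.range (E₀ : H →ₗ[ℂ] H))) ∧
    connectedComponentIn (Krein.jSelfadjointProjections J) E₀ = Krein.jOrbit J E₀ := by
  have : CompleteSpace (LinearMap.ker ((J - 1 : H →L[ℂ] H) : H →ₗ[ℂ] H)) :=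
    (ContinuousLinearMap.isClosed_ker (J - 1)).completeSpace_coe
  have : CompleteSpace (LinearMap.ker ((J + 1 : H →L[ℂ] H) : H →ₗ[ℂ] H)) :=
    (ContinuousLinearMap.isClosed_ker (J + 1)).completeSpace_coe
  -- The eigenspaces of `J` for `1` and `-1` supply the splitting used throughout.
  have h := Krein.isSplitting_subtypeL hJ
    (P := LinearMap.ker ((J - 1 : H →L[ℂ] H) : H →ₗ[ℂ] H))
    (N := LinearMap.ker ((J + 1 : H →L[ℂ] H) : H →ₗ[ℂ] H))
    (fun x => sub_eq_zero) (fun x => add_eq_zero_iff_eq_neg)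
  refine ⟨⟨h.sameSignatures_of_mem_jOrbit hJ hE₀, fun hs =>
    (h.mem_jOrbit_and_joinedIn_of_sameSignatures hJ hE hE₀ hs).1⟩, Set.Subset.antisymm ?_ ?_⟩
  · intro F hF
    exact (h.mem_jOrbit_and_joinedIn_of_sameSignatures hJ (connectedComponentIn_subset _ _ hF) hE₀
      (h.sameSignatures_of_mem_connectedComponentIn hJ hE₀ hF)).1
  · intro F hF
    have hF' : F ∈ Krein.jSelfadjointProjections J := by
      obtain ⟨V, hV, rfl⟩ := hF
      exact Krein.conj_mem_jSelfadjointProjections hJ hV hE₀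
    have hj := (h.mem_jOrbit_and_joinedIn_of_sameSignatures hJ hF' hE₀
      (h.sameSignatures_of_mem_jOrbit hJ hE₀ hF)).2
    obtain ⟨γ, hγ⟩ := hj
    exact (isPreconnected_range γ.continuous).subset_connectedComponentIn
      ⟨0, γ.source⟩ (Set.range_subset_iff.mpr hγ) ⟨1, γ.target⟩
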